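/- Let $n\ge 4$, let $M^n$ be a connected smooth Riemannian manifold and let $f\colon M^n\to\mathbb{R}^{n+m}$ be a smooth isometric immersion with second fundamental form $\alpha_f$ and mean curvature vector $\mathcal H_f=\frac1n\operatorname{tr}\alpha_f$. An isometric immersion of $M^n$ into a space of constant sectional curvature $c$ is called Wintgen ideal if at every point $s=c+\|\mathcal H_f\|^2-\frac{\|R^\perp\|}{n(n-1)}$, where $s$ is the normalized scalar curvature of $M^n$ and $R^\perp$ is the normal curvature tensor. Suppose that $f$ is Wintgen ideal. For each $x\in M^n$ let $e_1,\dots,e_n$ be an orthonormal basis of $T_xM$ and $\eta_1,\dots,\eta_m$ ($m\ge 3$) an orthonormal basis of the normal space of $f$ at $x$, with respect to which the shape operators $A_{\eta_a}$, defined by $\langle A_\xi X,Y\rangle=\langle\alpha_f(X,Y),\xi\rangle$, are $$A_{\eta_1}=\begin{bmatrix}\mu&&\\&-\mu&\\&&0\end{bmatrix},\quad A_{\eta_2}=\begin{bmatrix}\gamma_1&\mu&\\\mu&\gamma_1&\\&&\gamma_1I_{n-2}\end{bmatrix},\quad A_{\eta_3}=\gamma_2I_n,\quad A_{\eta_a}=0\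 \text{ for } a\ge 4,$$ for real functions $\mu,\gamma_1,\gamma_2$ on $M^n$ with $\mu\neq0$ everywhere. Assume that $\gamma_1=0$ and $\gamma_2\ne0$ everywhere. Then: 1. $|\gamma_2|$ is a positive constant. 2. If the sign of $\eta_3$ is chosen so that $\gamma_2$ is continuous (which is always possible, for instance with $\gamma_2>0$), then $\gamma_2$ is constant, and $\eta_3$ is a smooth normal vector field that is parallel in the normal connection of $f$. 3. There are a point $P\in\mathbb{R}^{n+m}$ and a radius $r>0$ such that $f(M)$ is contained in the round hypersphere $\mathbb{S}^{n+m-1}$ with centre $P$ and radius $r$, and $f$, as an immersion into this sphere (whose sectional curvature is $1/r^2$), is minimal and Wintgen ideal. -/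

import Mathlib

open Bundle
open scoped Manifold ContDiff RealInnerProductSpace

noncomputable section

namespace WintgenIdeal

/-! ### Intrinsic geometry: the scalar curvature of a Riemannian manifold

Everything is computed in the preferred chart `extChartAt (𝓡 n) x` around the point `x`.
Tangent vectors at `x` are, by the construction of `TangentSpace`, the coordinate vectors
of this same chart. -/

section Intrinsic

variable {n : ℕ} {M : Type*} [TopologicalSpace M] [ChartedSpace (EuclideanSpace ℝ (Fin n)) M]

/-- The coordinate vector field `∂_i` of the chart around `x`, at the point of `M` with
coordinates `u`. -/
def coordField (x : M) (u : EuclideanSpace ℝ (Fin n)) (i : Fin n) :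
    TangentSpace (𝓡 n) ((extChartAt (𝓡 n) x).symm u) :=
  mfderiv 𝓘(ℝ, EuclideanSpace ℝ (Fin n)) (𝓡 n) (extChartAt (𝓡 n) x).symm u
    (EuclideanSpace.single i (1 : ℝ) : EuclideanSpace ℝ (Fin n))

/-- The partial derivative `∂_i h` in `ℝⁿ`. -/
def partialDeriv (i : Fin n) (h : EuclideanSpace ℝ (Fin n) → ℝ)
    (u : EuclideanSpace ℝ (Fin n)) : ℝ :=
  fderiv ℝ h u (EuclideanSpace.single i (1 : ℝ))

variable [RiemannianBundle (fun y : M => TangentSpace (𝓡 n) y)]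

/-- The matrix `g_{ij} = ⟨∂_i, ∂_j⟩` of the Riemannian metric in the chart around `x`. -/
def gram (x : M) (u : EuclideanSpace ℝ (Fin n)) : Matrix (Fin n) (Fin n) ℝ :=
  Matrix.of fun i j => ⟪coordField x u i, coordField x u j⟫

/-- The Christoffel symbol `Γ^k_{ij}` of the Levi-Civita connection in the chart around `x`. -/
def christoffel (x : M) (k i j : Fin n) (u : EuclideanSpace ℝ (Fin n)) : ℝ :=
  1 / 2 * ∑ l, (gram x u)⁻¹ k l *
    (partialDeriv i (fun w => gram x w j l) u + partialDeriv j (fun w => gram x w i l) u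
      - partialDeriv l (fun w => gram x w i j) u)

/-- The component `R^l_{ijk}` of the curvature tensor `R(X,Y)Z = ∇_X∇_Y Z - ∇_Y∇_X Z - ∇_[X,Y] Z`,
where `R(∂_i,∂_j)∂_k = ∑ l, R^l_{ijk} ∂_l`. -/
def curvature (x : M) (l i j k : Fin n) (u : EuclideanSpace ℝ (Fin n)) : ℝ :=
  partialDeriv i (christoffel x l j k) u - partialDeriv j (christoffel x l i k) u
    + ∑ p, (christoffel x l i p u * christoffel x p j k u
      - christoffel x l j p u * christoffel x p i k u)

/-- The component `Ric_{jk} = ∑ i, R^i_{ijk}` of the Ricci tensor. -/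
def ricci (x : M) (j k : Fin n) (u : EuclideanSpace ℝ (Fin n)) : ℝ :=
  ∑ i, curvature x i i j k u

/-- The normalized scalar curvature `s = (1 / (n(n-1))) ∑ g^{jk} Ric_{jk}` at `x`. It equals the
average of the sectional curvatures, so that it is `1` on the unit sphere. -/
def normalizedScalarCurvature (x : M) : ℝ :=
  (∑ j, ∑ k, (gram x (extChartAt (𝓡 n) x x))⁻¹ j k * ricci x j k (extChartAt (𝓡 n) x x))
    / ((n : ℝ) * ((n : ℝ) - 1))

end Intrinsic

/-! ### Ambient spaces

We consider immersions into `ℝᵈ` and into round hyperspheres of `ℝᵈ`. The ambient space `Q` is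
described by its tangent spaces `V y = T_y Q`, viewed as subspaces of `ℝᵈ`. The Levi-Civita
connection of `Q` is the orthogonal projection to `V` of the derivative in `ℝᵈ`; therefore the
second fundamental form and the normal connection of a submanifold of `Q` are obtained by
projecting the derivatives in `ℝᵈ` to the normal space of the submanifold in `Q`. -/

section Ambient

variable {d : ℕ}

/-- The tangent spaces of `ℝᵈ`. -/
def euclideanTangent (_y : EuclideanSpace ℝ (Fin d)) : Submodule ℝ (EuclideanSpace ℝ (Fin d)) := ⊤

/-- The tangent space at `y` of the round hypersphere of `ℝᵈ` centred at `P` which contains `y`: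
the orthogonal complement of the radial direction. -/
def sphereTangent (P y : EuclideanSpace ℝ (Fin d)) : Submodule ℝ (EuclideanSpace ℝ (Fin d)) :=
  (Submodule.span ℝ {y - P})ᗮ

end Ambient

/-! ### Extrinsic geometry -/

section Extrinsic

variable {n d : ℕ} {M : Type*} [TopologicalSpace M] [ChartedSpace (EuclideanSpace ℝ (Fin n)) M]

/-- The differential `f_* = df_x : T_x M → ℝᵈ`. -/
def differential (f : M → EuclideanSpace ℝ (Fin d)) (x : M) :
    TangentSpace (𝓡 n) x →L[ℝ] EuclideanSpace ℝ (Fin d) :=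
  mfderiv (𝓡 n) 𝓘(ℝ, EuclideanSpace ℝ (Fin d)) f x

/-- The tangent space `f_* T_x M`, as a subspace of `ℝᵈ`. -/
def tangentImage (f : M → EuclideanSpace ℝ (Fin d)) (x : M) :
    Submodule ℝ (EuclideanSpace ℝ (Fin d)) :=
  LinearMap.range (differential (n := n) f x).toLinearMap

variable (V : EuclideanSpace ℝ (Fin d) → Submodule ℝ (EuclideanSpace ℝ (Fin d)))
  (f : M → EuclideanSpace ℝ (Fin d))

/-- The normal space of `f` at `x`, in the ambient space with tangent spaces `V`. -/
def normalSpace (x : M) : Submodule ℝ (EuclideanSpace ℝ (Fin d)) :=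
  V (f x) ⊓ (tangentImage (n := n) f x)ᗮ

/-- The orthogonal projection of `ℝᵈ` to the normal space at `x`. -/
def normalProj (x : M) : EuclideanSpace ℝ (Fin d) →L[ℝ] EuclideanSpace ℝ (Fin d) :=
  (normalSpace (n := n) V f x).starProjection

/-- The second fundamental form `α_f(X, Y) = (D_X f_* Y)^⊥` at `x`: the normal component of the
second derivative of `f` in the preferred chart around `x`. -/
def secondFundamentalForm (x : M) (X Y : TangentSpace (𝓡 n) x) : EuclideanSpace ℝ (Fin d) :=
  normalProj (n := n) V f x
    (fderiv ℝ (fderiv ℝ (f ∘ (extChartAt (𝓡 n) x).symm)) (extChartAt (𝓡 n) x x)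
      (X : EuclideanSpace ℝ (Fin n)) (Y : EuclideanSpace ℝ (Fin n)))

/-- In the chart around `x`: the normal covariant derivative `∇^⊥_X ξ` of a field `ξ` along `f`, for
a vector `X` with constant coordinates. -/
def chartNormalDeriv (x : M) (X : EuclideanSpace ℝ (Fin n))
    (ξ : EuclideanSpace ℝ (Fin n) → EuclideanSpace ℝ (Fin d)) (u : EuclideanSpace ℝ (Fin n)) :
    EuclideanSpace ℝ (Fin d) :=
  normalProj (n := n) V f ((extChartAt (𝓡 n) x).symm u) (fderiv ℝ ξ u X)

/-- The normal curvature tensor `R^⊥(X,Y)ξ = ∇^⊥_X ∇^⊥_Y ξ - ∇^⊥_Y ∇^⊥_X ξ - ∇^⊥_[X,Y] ξ` at `x`.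
Here `X`, `Y` are extended with constant coordinates in the chart around `x`, so that
`[X,Y] = 0`, and the normal vector `ξ` is extended to the normal field `u ↦ (ξ)^⊥`. -/
def normalCurvature (x : M) (X Y : TangentSpace (𝓡 n) x) (ξ : EuclideanSpace ℝ (Fin d)) :
    EuclideanSpace ℝ (Fin d) :=
  let ξ' : EuclideanSpace ℝ (Fin n) → EuclideanSpace ℝ (Fin d) :=
    fun u => normalProj (n := n) V f ((extChartAt (𝓡 n) x).symm u) ξ
  chartNormalDeriv V f x X (chartNormalDeriv V f x Y ξ') (extChartAt (𝓡 n) x x)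
    - chartNormalDeriv V f x Y (chartNormalDeriv V f x X ξ') (extChartAt (𝓡 n) x x)

/-- A smooth normal vector field `η` of `f` that is parallel in the normal connection:
`∇^⊥_X η = (D_X η)^⊥ = 0` for every tangent vector `X`. -/
structure IsParallelNormalField (η : M → EuclideanSpace ℝ (Fin d)) : Prop where
  smooth : ContMDiff (𝓡 n) 𝓘(ℝ, EuclideanSpace ℝ (Fin d)) ∞ η
  normal : ∀ x, η x ∈ normalSpace (n := n) V f x
  parallel : ∀ (x : M) (X : TangentSpace (𝓡 n) x),
    normalProj (n := n) V f x (differential η x X) = 0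

variable [RiemannianBundle (fun y : M => TangentSpace (𝓡 n) y)]

/-- `f` is a smooth isometric immersion of the Riemannian manifold `M` into `ℝᵈ`. -/
structure IsIsometricImmersion : Prop where
  smooth : ContMDiff (𝓡 n) 𝓘(ℝ, EuclideanSpace ℝ (Fin d)) ∞ f
  isometric : ∀ (x : M) (X Y : TangentSpace (𝓡 n) x),
    ⟪differential f x X, differential f x Y⟫ = ⟪X, Y⟫

/-- An orthonormal basis of `T_x M`. -/
def tangentONB (x : M) : OrthonormalBasis (Fin n) ℝ (TangentSpace (𝓡 n) x) :=
  haveI : FiniteDimensional ℝ (TangentSpace (𝓡 n) x) :=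
    inferInstanceAs (FiniteDimensional ℝ (EuclideanSpace ℝ (Fin n)))
  (stdOrthonormalBasis ℝ (TangentSpace (𝓡 n) x)).reindex
    (finCongr (finrank_euclideanSpace_fin (𝕜 := ℝ) (n := n)))

/-- The mean curvature vector `H_f = (1/n) ∑ i, α_f(e_i, e_i)` at `x`. -/
def meanCurvature (x : M) : EuclideanSpace ℝ (Fin d) :=
  (1 / (n : ℝ)) • ∑ i : Fin n, secondFundamentalForm V f x (tangentONB (n := n) x i) (tangentONB (n := n) x i)

/-- The norm of the normal curvature tensor at `x`:
`‖R^⊥‖² = ∑ i j a, ‖R^⊥(e_i, e_j) ξ_a‖²` over orthonormal bases of the tangent and of the normal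
space. -/
def normNormalCurvature (x : M) : ℝ :=
  Real.sqrt (∑ i : Fin n, ∑ j : Fin n, ∑ a,
    ‖normalCurvature V f x (tangentONB (n := n) x i) (tangentONB (n := n) x j)
    (stdOrthonormalBasis ℝ (normalSpace (n := n) V f x) a : EuclideanSpace ℝ (Fin d))‖ ^ 2)

/-- `f` is a Wintgen ideal submanifold of the ambient space with tangent spaces `V` and constant
sectional curvature `c`: at every point the DDVV inequality `s ≤ c + H² - s^⊥`, with
`s^⊥ = ‖R^⊥‖ / (n(n-1))`, is an equality. -/
def IsWintgenIdeal (c : ℝ) : Prop :=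
  ∀ x : M, normalizedScalarCurvature (n := n) x =
    c + ‖meanCurvature (n := n) V f x‖ ^ 2
      - normNormalCurvature (n := n) V f x / ((n : ℝ) * ((n : ℝ) - 1))

/-- `f` is minimal in the ambient space with tangent spaces `V`. -/
def IsMinimal : Prop := ∀ x : M, meanCurvature (n := n) V f x = 0

/-- The matrices, in the tangent frame `e_1, …, e_n`, of the shape operators `A_{η_1}`, `A_{η_2}`,
`A_{η_3}` and `A_{η_a}`, `a ≥ 4`, of a Wintgen ideal submanifold (indices start at `0` here):
`A_{η_1} = diag(μ, -μ, 0, …, 0)`, `A_{η_2} = γ₁ I + μ (E₁₂ + E₂₁)`, `A_{η_3} = γ₂ I`,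
and `A_{η_a} = 0` for `a ≥ 4`. -/
def wintgenMatrix (n : ℕ) (μ γ₁ γ₂ : ℝ) (a : ℕ) : Matrix (Fin n) (Fin n) ℝ :=
  Matrix.of fun i j =>
    match a with
    | 0 => if i = j then (if i.val = 0 then μ else if i.val = 1 then -μ else 0) else 0
    | 1 => if i = j then γ₁
        else if (i.val = 0 ∧ j.val = 1) ∨ (i.val = 1 ∧ j.val = 0) then μ else 0
    | 2 => if i = j then γ₂ else 0
    | _ => 0

/-- `e` and `η` are orthonormal bases of the tangent and of the normal space of `f` at `x` with
respect to which the shape operators, `⟨A_ξ X, Y⟩ = ⟨α_f(X, Y), ξ⟩`, have the canonical form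
`wintgenMatrix` with the parameters `μ`, `γ₁`, `γ₂`. -/
def IsWintgenFrame {m : ℕ} (x : M) (e : OrthonormalBasis (Fin n) ℝ (TangentSpace (𝓡 n) x))
    (η : OrthonormalBasis (Fin m) ℝ (normalSpace (n := n) V f x)) (μ γ₁ γ₂ : ℝ) : Prop :=
  ∀ (a : Fin m) (i j : Fin n),
    ⟪secondFundamentalForm V f x (e i) (e j), (η a : EuclideanSpace ℝ (Fin d))⟫
      = wintgenMatrix n μ γ₁ γ₂ a i j

end Extrinsic

end WintgenIdeal

end

/-!
The hypotheses say that the second fundamental form is `α = ⟨·,·⟩ H + β`, where `H = γ₂ η₃` is the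
mean curvature vector and the traceless part `β` takes values in the span of `η₁`, `η₂` and has as
nullity `Δ` the span of `e₃, …, eₙ`, of dimension at least two. The whole theorem rests on the fact
that `H` is parallel in the normal connection (`fderiv_meanCurvature`), which is extracted from the
Codazzi equation

  `(∇_Z β)(X, Y) + ⟨X, Y⟩ ∇^⊥_Z H` is symmetric in `X` and `Z`   (`codazzi`).

Since `Δ` extends to smooth fields, `(∇_Z β)(X, ·)` for `X` in `Δ` has values in the image of `β`
(`exists_fderiv_traceless_eq`). With `X = Y` a unit vector of `Δ` and `Z` orthogonal to `X` this
gives `∇^⊥_Z H = β(Z, ξ)` for some `ξ` that depends on `X` only. As `Δ` has dimension at least two,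
`∇^⊥_Z H = 0` for `Z` in `Δ`, and `∇^⊥ H` is orthogonal to `H`. Because `β` is orthogonal to `H`, the
`H`-component of the Codazzi equation then says that `⟨β(X, Y), ∇^⊥_Z H⟩` is symmetric in `X` and
`Z`; evaluated on `e₁`, `e₂` this forces the components of `ξ` in `e₁`, `e₂` to vanish. Hence
`∇^⊥ H = 0`. Since the shape operator of `H` is `‖H‖² I`, the derivative of `H` is `-‖H‖² df`.

The frames are not assumed to depend continuously on the point. `H` is nevertheless smooth, being a
trace of the second fundamental form, and all computations are made with `H` and `β` in a fixed
chart, where the frames only serve to describe `H` and `β` pointwise.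

It follows that `|γ₂| = ‖H‖` and the point `P = f + H / ‖H‖²` are constant, so that `f` has values in
the sphere with centre `P` and radius `1 / |γ₂|`. Passing to this sphere removes the direction of `H`
from the normal space. This makes the mean curvature zero, and it does not change the normal
curvature tensor, which annihilates the parallel field `H` (`normalCurvature_sphereTangent`).
Therefore the equality `s = ‖H‖² - ‖R^⊥‖ / (n(n-1))` in Euclidean space is the corresponding equality
in the sphere, of curvature `‖H‖²`.
-/

noncomputable section

namespace WintgenIdeal

/-! ### The normal projection of an injective linear map -/

section LinearAlgebra

variable {E W : Type*} [NormedAddCommGroup E] [InnerProductSpace ℝ E] [FiniteDimensional ℝ E]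
  [NormedAddCommGroup W] [InnerProductSpace ℝ W] [FiniteDimensional ℝ W]

/-- The inverse `(A†A)⁻¹` of the Gram operator of `A`; it is `0` if `A` is not injective. -/
def gramInv (A : E →L[ℝ] W) : E →L[ℝ] E :=
  Ring.inverse (ContinuousLinearMap.adjoint A ∘L A)

/-- The map `(A†A)⁻¹A†`, which sends `w` to the vector whose image under `A` is the component
of `w` in the range of `A`. -/
def tangentPart (A : E →L[ℝ] W) : W →L[ℝ] E :=
  gramInv A ∘L ContinuousLinearMap.adjoint A

/-- The projection `1 - A(A†A)⁻¹A†` to the orthogonal complement of the range of `A`. -/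
def normalPart (A : E →L[ℝ] W) : W →L[ℝ] W :=
  ContinuousLinearMap.id ℝ W - A ∘L tangentPart A

variable {A : E →L[ℝ] W}

lemma isUnit_gram (hA : Function.Injective A) :
    IsUnit (ContinuousLinearMap.adjoint A ∘L A) := by
  rw [ContinuousLinearMap.isUnit_iff_bijective]
  have hinj : Function.Injective (ContinuousLinearMap.adjoint A ∘L A) := by
    rw [injective_iff_map_eq_zero]
    intro x hx
    have h : ⟪A x, A x⟫ = 0 := by
      rw [← ContinuousLinearMap.adjoint_inner_left]
      simpa using congrArg (fun y => ⟪y, x⟫) hx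
    exact (injective_iff_map_eq_zero A).1 hA x (inner_self_eq_zero.1 h)
  exact ⟨hinj, LinearMap.injective_iff_surjective
    (f := (ContinuousLinearMap.adjoint A ∘L A).toLinearMap).1 hinj⟩

lemma tangentPart_apply (hA : Function.Injective A) (x : E) : tangentPart A (A x) = x := by
  have h := Ring.inverse_mul_cancel _ (isUnit_gram hA)
  exact congrArg (fun T : E →L[ℝ] E => T x) h

lemma inner_apply_tangentPart (hA : Function.Injective A) (x : E) (w : W) :
    ⟪A x, A (tangentPart A w)⟫ = ⟪A x, w⟫ := by
  have h := Ring.mul_inverse_cancel _ (isUnit_gram hA)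
  have h' : ContinuousLinearMap.adjoint A (A (tangentPart A w))
      = ContinuousLinearMap.adjoint A w :=
    congrArg (fun T : E →L[ℝ] E => T (ContinuousLinearMap.adjoint A w)) h
  rw [← ContinuousLinearMap.adjoint_inner_right, h', ContinuousLinearMap.adjoint_inner_right]

lemma normalPart_eq (A : E →L[ℝ] W) (w : W) : normalPart A w = w - A (tangentPart A w) := rfl

lemma normalPart_apply_range (hA : Function.Injective A) (x : E) : normalPart A (A x) = 0 := by
  rw [normalPart_eq, tangentPart_apply hA, sub_self]

lemma inner_apply_normalPart (hA : Function.Injective A) (x : E) (w : W) :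
    ⟪A x, normalPart A w⟫ = 0 := by
  rw [normalPart_eq, inner_sub_right, inner_apply_tangentPart hA, sub_self]

lemma normalPart_of_orthogonal (A : E →L[ℝ] W) {w : W} (hw : ∀ x, ⟪A x, w⟫ = 0) :
    normalPart A w = w := by
  have h : ContinuousLinearMap.adjoint A w = 0 := by
    refine ext_inner_left ℝ fun x => ?_
    rw [ContinuousLinearMap.adjoint_inner_right, hw, inner_zero_right]
  simp [normalPart_eq, tangentPart, h]

lemma inner_normalPart_left (hA : Function.Injective A) (v w : W) :
    ⟪normalPart A v, w⟫ = ⟪normalPart A v, normalPart A w⟫ := by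
  rw [normalPart_eq A w, inner_sub_right, real_inner_comm (A _), inner_apply_normalPart hA,
    sub_zero]

lemma inner_normalPart_comm (hA : Function.Injective A) (v w : W) :
    ⟪normalPart A v, w⟫ = ⟪v, normalPart A w⟫ := by
  rw [inner_normalPart_left hA, real_inner_comm, ← inner_normalPart_left hA, real_inner_comm]

lemma starProjection_eq_normalPart (hA : Function.Injective A) (K : Submodule ℝ W)
    (hK : K = (LinearMap.range A.toLinearMap)ᗮ) : K.starProjection = normalPart A := by
  subst hK
  refine ContinuousLinearMap.ext fun w => ?_
  refine Submodule.eq_starProjection_of_mem_orthogonal ?_ ?_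
  · rw [Submodule.mem_orthogonal]
    rintro _ ⟨x, rfl⟩
    exact inner_apply_normalPart hA x w
  · rw [normalPart_eq, sub_sub_cancel]
    exact Submodule.le_orthogonal_orthogonal _ ⟨_, rfl⟩

lemma contDiffAt_gramInv (hA : Function.Injective A) :
    ContDiffAt ℝ ∞ (gramInv : (E →L[ℝ] W) → E →L[ℝ] E) A := by
  have hadj : ContDiff ℝ ∞ (fun B : E →L[ℝ] W => ContinuousLinearMap.adjoint B) :=
    (ContinuousLinearMap.adjoint (𝕜 := ℝ) (E := E) (F := W)).contDiff
  obtain ⟨g, hg⟩ := isUnit_gram hA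
  have h1 : ContDiffAt ℝ ∞ (Ring.inverse : (E →L[ℝ] E) → (E →L[ℝ] E))
      (ContinuousLinearMap.adjoint A ∘L A) := hg ▸ contDiffAt_ringInverse ℝ g
  exact ContDiffAt.comp A h1 (hadj.clm_comp contDiff_id).contDiffAt

lemma contDiffAt_tangentPart (hA : Function.Injective A) :
    ContDiffAt ℝ ∞ (tangentPart : (E →L[ℝ] W) → W →L[ℝ] E) A :=
  (contDiffAt_gramInv hA).clm_comp
    (ContinuousLinearMap.adjoint (𝕜 := ℝ) (E := E) (F := W)).contDiff.contDiffAt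

lemma contDiffAt_normalPart (hA : Function.Injective A) :
    ContDiffAt ℝ ∞ (normalPart : (E →L[ℝ] W) → W →L[ℝ] W) A :=
  contDiffAt_const.sub (contDiffAt_id.clm_comp (contDiffAt_tangentPart hA))

/-- The trace of a bilinear form with respect to the scalar product pulled back by `A`, written in
a fixed orthonormal basis `b`. In this form it depends smoothly on `A`, and it shows that the trace
does not depend on the frame `v`. -/
lemma sum_apply_eq_sum_gramInv {ι : Type*} [Fintype ι] [DecidableEq ι]
    (hA : Function.Injective A) (v : Module.Basis ι ℝ E)
    (hv : ∀ i j, ⟪A (v i), A (v j)⟫ = if i = j then 1 else 0)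
    {κ : Type*} [Fintype κ] (b : OrthonormalBasis κ ℝ E) (B : E →L[ℝ] E →L[ℝ] W) :
    ∑ i, B (v i) (v i) = ∑ k, B (gramInv A (b k)) (b k) := by
  have hG : ∀ w, gramInv A w = ∑ i, ⟪v i, w⟫ • v i := by
    intro w
    have h := Ring.mul_inverse_cancel _ (isUnit_gram hA)
    have hinj := (ContinuousLinearMap.isUnit_iff_bijective.1 (isUnit_gram hA)).1
    apply hinj
    have h' : (ContinuousLinearMap.adjoint A ∘L A) (gramInv A w) = w :=
      congrArg (fun T : E →L[ℝ] E => T w) h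
    rw [h']
    refine InnerProductSpace.ext_inner_left_basis v fun j => ?_
    rw [ContinuousLinearMap.comp_apply, ContinuousLinearMap.adjoint_inner_right]
    simp [map_sum, inner_sum, inner_smul_right, hv]
  have hb : ∀ i, v i = ∑ k, ⟪v i, b k⟫ • b k := by
    intro i
    simpa [real_inner_comm] using (b.sum_repr' (v i)).symm
  calc ∑ i, B (v i) (v i) = ∑ i, ∑ k, ⟪v i, b k⟫ • B (v i) (b k) := by
        refine Finset.sum_congr rfl fun i _ => ?_
        conv_lhs => rw [show B (v i) (v i) = B (v i) (∑ k, ⟪v i, b k⟫ • b k) by rw [← hb]]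
        simp [map_sum]
    _ = ∑ k, B (gramInv A (b k)) (b k) := by
        rw [Finset.sum_comm]
        refine Finset.sum_congr rfl fun k _ => ?_
        rw [hG]
        simp [map_sum]

/-- The Hilbert–Schmidt norm of the restriction of `T` to a subspace `K`, computed in an
orthonormal basis of the whole space. -/
lemma sum_norm_sq_subspace {ι κ : Type*} [Fintype ι] [Fintype κ] (T : W →L[ℝ] W)
    (K : Submodule ℝ W) (ξ : OrthonormalBasis ι ℝ K) (b : OrthonormalBasis κ ℝ W) :
    ∑ a, ‖T (ξ a : W)‖ ^ 2 = ∑ k, ‖T (K.starProjection (b k))‖ ^ 2 := by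
  have h1 : ∀ w : W, ‖w‖ ^ 2 = ∑ j, ⟪w, b j⟫ ^ 2 := fun w => by
    rw [← real_inner_self_eq_norm_sq, ← b.sum_inner_mul_inner]
    exact Finset.sum_congr rfl fun j _ => by rw [real_inner_comm w, sq]
  have h2 : ∀ w : W, ∑ a, ⟪(ξ a : W), w⟫ ^ 2 = ∑ k, ⟪K.starProjection (b k), w⟫ ^ 2 := by
    intro w
    have e1 : ∑ k, ⟪K.starProjection (b k), w⟫ ^ 2 = ‖K.starProjection w‖ ^ 2 := by
      rw [h1]
      refine Finset.sum_congr rfl fun k _ => ?_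
      rw [Submodule.inner_starProjection_left_eq_right, real_inner_comm]
    have e2 : ‖K.starProjection w‖ ^ 2 = ‖K.orthogonalProjectionOnto w‖ ^ 2 := rfl
    rw [e1, e2, ← real_inner_self_eq_norm_sq, ← ξ.sum_inner_mul_inner]
    refine Finset.sum_congr rfl fun a _ => ?_
    have e3 : ⟪(ξ a : W), w⟫ = ⟪ξ a, K.orthogonalProjectionOnto w⟫ := by
      rw [Submodule.inner_orthogonalProjectionOnto_eq_of_mem_left]
    rw [real_inner_comm (ξ a) (K.orthogonalProjectionOnto w), ← e3, sq]
  simp_rw [h1]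
  rw [Finset.sum_comm]
  conv_rhs => rw [Finset.sum_comm]
  refine Finset.sum_congr rfl fun j _ => ?_
  have := h2 (ContinuousLinearMap.adjoint T (b j))
  simpa only [ContinuousLinearMap.adjoint_inner_right] using this

end LinearAlgebra

/-! ### Immersions of an open set with adapted frames -/

section LocalTheory

lemma basis_coord_self {ι E : Type*} [AddCommGroup E] [Module ℝ E] [DecidableEq ι]
    (v : Module.Basis ι ℝ E) (i j : ι) :
    v.coord i (v j) = if i = j then 1 else 0 := by
  rw [Module.Basis.coord_apply, Module.Basis.repr_self, Finsupp.single_apply]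
  simp only [eq_comm]

lemma two_le_smooth : minSmoothness ℝ 2 ≤ (∞ : WithTop ℕ∞) := by
  rw [minSmoothness_of_isRCLikeNormedField]
  exact WithTop.coe_le_coe.2 (le_top : (2 : ℕ∞) ≤ ⊤)

variable {E W : Type*} [NormedAddCommGroup E] [InnerProductSpace ℝ E] [FiniteDimensional ℝ E]
  [NormedAddCommGroup W] [InnerProductSpace ℝ W] [FiniteDimensional ℝ W]
  {ι : Type*} [DecidableEq ι]

/-- The second derivative `S` of an immersion with differential `A` has the canonical form of a
Wintgen ideal immersion with `γ₁ = 0`: the normal component of `S` is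
`⟨X, Y⟩ h + β(X, Y)`, where `h` is the mean curvature vector and the traceless part `β` only
involves the coordinates `o`, `l` in the frame `v`, which is orthonormal for the induced metric,
and the normal vectors `p`, `q`. -/
structure IsAdaptedFrame (A : E →L[ℝ] W) (S : E →L[ℝ] E →L[ℝ] W) (o l : ι)
    (v : Module.Basis ι ℝ E) (μ : ℝ) (p q h : W) : Prop where
  orthonormal : ∀ i j, ⟪A (v i), A (v j)⟫ = if i = j then (1 : ℝ) else 0
  ne_zero : μ ≠ 0
  normal_p : ∀ X, ⟪A X, p⟫ = 0
  normal_q : ∀ X, ⟪A X, q⟫ = 0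
  normal_h : ∀ X, ⟪A X, h⟫ = 0
  inner_p_p : ⟪p, p⟫ = 1
  inner_q_q : ⟪q, q⟫ = 1
  inner_p_q : ⟪p, q⟫ = 0
  inner_p_h : ⟪p, h⟫ = 0
  inner_q_h : ⟪q, h⟫ = 0
  form : ∀ X Y, normalPart A (S X Y) = ⟪A X, A Y⟫ • h
    + (μ * (v.coord o X * v.coord o Y - v.coord l X * v.coord l Y)) • p
    + (μ * (v.coord o X * v.coord l Y + v.coord l X * v.coord o Y)) • q

/-- The traceless part `β = α - ⟨·,·⟩ H` of the second fundamental form of `F`. -/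
def traceless (F H : E → W) (u X Y : E) : W :=
  normalPart (fderiv ℝ F u) (fderiv ℝ (fderiv ℝ F) u X Y)
    - ⟪fderiv ℝ F u X, fderiv ℝ F u Y⟫ • H u

lemma traceless_linear_right (F H : E → W) (u X Y Z : E) (s t : ℝ) :
    traceless F H u X (s • Y + t • Z) = s • traceless F H u X Y + t • traceless F H u X Z := by
  simp only [traceless, map_add, map_smul, inner_add_right, inner_smul_right, add_smul, smul_sub,
    mul_smul]
  abel

lemma traceless_linear_left (F H : E → W) (u X Y Z : E) (s t : ℝ) :
    traceless F H u (s • Y + t • Z) X = s • traceless F H u Y X + t • traceless F H u Z X := by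
  simp only [traceless, map_add, map_smul, inner_add_left, inner_smul_left, add_smul, smul_sub,
    mul_smul, add_apply, smul_apply, conj_trivial]
  abel

lemma traceless_eq {F H : E → W} {o l : ι} {u : E} {v : Module.Basis ι ℝ E} {μ : ℝ} {p q : W}
    (hv : IsAdaptedFrame (fderiv ℝ F u) (fderiv ℝ (fderiv ℝ F) u) o l v μ p q (H u)) (X Y : E) :
    traceless F H u X Y
      = (μ * (v.coord o X * v.coord o Y - v.coord l X * v.coord l Y)) • p
        + (μ * (v.coord o X * v.coord l Y + v.coord l X * v.coord o Y)) • q := by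
  rw [traceless, hv.form]
  abel

variable [Fintype ι]

namespace IsAdaptedFrame

variable {A : E →L[ℝ] W} {S : E →L[ℝ] E →L[ℝ] W} {o l : ι} {v : Module.Basis ι ℝ E} {μ : ℝ}
  {p q h : W}

lemma coord_eq (hF : IsAdaptedFrame A S o l v μ p q h) (i : ι) (X : E) :
    v.coord i X = ⟪A (v i), A X⟫ := by
  conv_rhs => rw [← v.sum_repr X]
  simp only [map_sum, map_smul, inner_sum, inner_smul_right, hF.orthonormal, mul_ite, mul_one,
    mul_zero, Finset.sum_ite_eq, Finset.mem_univ, if_true, Module.Basis.coord_apply]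

lemma injective (hF : IsAdaptedFrame A S o l v μ p q h) : Function.Injective A := by
  rw [injective_iff_map_eq_zero]
  intro X hX
  refine v.ext_elem fun i => ?_
  rw [← v.coord_apply, hF.coord_eq, hX, inner_zero_right]
  simp

/-- The trace of the second fundamental form is a multiple of `h`, because `β` is traceless. -/
lemma trace_eq (hF : IsAdaptedFrame A S o l v μ p q h) (hol : o ≠ l) {κ : Type*} [Fintype κ]
    (b : OrthonormalBasis κ ℝ E) :
    normalPart A (∑ k, S (gramInv A (b k)) (b k)) = (Fintype.card ι : ℝ) • h := by
  rw [← sum_apply_eq_sum_gramInv hF.injective v hF.orthonormal b S, map_sum]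
  simp only [hF.form, hF.orthonormal, basis_coord_self, if_true, one_smul, Finset.sum_add_distrib,
    ← Finset.sum_smul, ← Finset.mul_sum]
  have h1 : ∑ i : ι, ((if o = i then (1 : ℝ) else 0) * (if o = i then 1 else 0)
      - (if l = i then 1 else 0) * (if l = i then 1 else 0)) = 0 := by simp
  have h2 : ∑ i : ι, ((if o = i then (1 : ℝ) else 0) * (if l = i then 1 else 0)
      + (if l = i then 1 else 0) * (if o = i then 1 else 0)) = 0 := by
    refine Finset.sum_eq_zero fun i _ => ?_
    by_cases h1 : o = i
    · subst h1; simp [hol.symm]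
    · simp [h1]
  rw [Finset.sum_add_distrib] at h2
  rw [h1, h2]
  simp [← Nat.cast_smul_eq_nsmul ℝ]

end IsAdaptedFrame

variable {F H : E → W} {U : Set E} {o l : ι}

/-- The mean curvature vector of an immersion with adapted frames is smooth, although the frames
themselves are not assumed to be continuous. -/
lemma contDiffAt_of_frames (hol : o ≠ l) (hU : IsOpen U) (hF : ContDiffOn ℝ ∞ F U)
    (hfr : ∀ u ∈ U, ∃ v μ p q, IsAdaptedFrame (fderiv ℝ F u) (fderiv ℝ (fderiv ℝ F) u)
      o l v μ p q (H u)) {u : E} (hu : u ∈ U) : ContDiffAt ℝ ∞ H u := by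
  have hF' := hF.contDiffAt (hU.mem_nhds hu)
  have h1 : ContDiffAt ℝ ∞ (fderiv ℝ F) u := hF'.fderiv_right (by simp)
  have h2 : ContDiffAt ℝ ∞ (fderiv ℝ (fderiv ℝ F)) u := h1.fderiv_right (by simp)
  obtain ⟨v, μ, p, q, hv⟩ := hfr u hu
  let b := stdOrthonormalBasis ℝ E
  have h3 : ContDiffAt ℝ ∞ (fun w => (Fintype.card ι : ℝ)⁻¹ • normalPart (fderiv ℝ F w)
      (∑ k, fderiv ℝ (fderiv ℝ F) w (gramInv (fderiv ℝ F w) (b k)) (b k))) u := by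
    have hN : ContDiffAt ℝ ∞ (fun w => normalPart (fderiv ℝ F w)) u :=
      (contDiffAt_normalPart hv.injective).comp u h1
    have hG : ContDiffAt ℝ ∞ (fun w => gramInv (fderiv ℝ F w)) u :=
      (contDiffAt_gramInv hv.injective).comp u h1
    refine contDiffAt_const.smul (hN.clm_apply (ContDiffAt.sum fun k _ => ?_))
    exact (h2.clm_apply (hG.clm_apply contDiffAt_const)).clm_apply contDiffAt_const
  refine h3.congr_of_eventuallyEq ?_
  filter_upwards [hU.mem_nhds hu] with w hw
  obtain ⟨v, μ, p, q, hv⟩ := hfr w hw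
  have : Nonempty ι := ⟨o⟩
  rw [hv.trace_eq hol b, smul_smul, inv_mul_cancel₀ (by simp), one_smul]

/-- The smoothness of the data at a point of `U`. -/
lemma differentiableAt_data (hol : o ≠ l) (hU : IsOpen U) (hF : ContDiffOn ℝ ∞ F U)
    (hfr : ∀ u ∈ U, ∃ v μ p q, IsAdaptedFrame (fderiv ℝ F u) (fderiv ℝ (fderiv ℝ F) u)
      o l v μ p q (H u)) {u : E} (hu : u ∈ U) :
    DifferentiableAt ℝ (fderiv ℝ F) u ∧ DifferentiableAt ℝ (fderiv ℝ (fderiv ℝ F)) u ∧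
      DifferentiableAt ℝ H u ∧
      DifferentiableAt ℝ (fun w => tangentPart (fderiv ℝ F w)) u ∧
      ∀ X Y, DifferentiableAt ℝ (fun w => traceless F H w X Y) u := by
  have h1 : ContDiffAt ℝ ∞ (fderiv ℝ F) u :=
    (hF.contDiffAt (hU.mem_nhds hu)).fderiv_right (by simp)
  have h2 : ContDiffAt ℝ ∞ (fderiv ℝ (fderiv ℝ F)) u := h1.fderiv_right (by simp)
  have h3 := contDiffAt_of_frames hol hU hF hfr hu
  obtain ⟨v, μ, p, q, hv⟩ := hfr u hu
  have hN : ContDiffAt ℝ ∞ (fun w => normalPart (fderiv ℝ F w)) u :=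
    (contDiffAt_normalPart hv.injective).comp u h1
  have hT : ContDiffAt ℝ ∞ (fun w => tangentPart (fderiv ℝ F w)) u :=
    (contDiffAt_tangentPart hv.injective).comp u h1
  refine ⟨h1.differentiableAt (by simp), h2.differentiableAt (by simp),
    h3.differentiableAt (by simp), hT.differentiableAt (by simp), fun X Y => ?_⟩
  have h1X : ∀ X, ContDiffAt ℝ ∞ (fun w => fderiv ℝ F w X) u :=
    fun X => h1.clm_apply contDiffAt_const
  have hβ : ContDiffAt ℝ ∞ (fun w => traceless F H w X Y) u :=
    (hN.clm_apply ((h2.clm_apply contDiffAt_const).clm_apply contDiffAt_const)).sub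
      (((h1X X).inner ℝ (h1X Y)).smul h3)
  exact hβ.differentiableAt (by simp)

/-- The Codazzi equation, for a second fundamental form `⟨·,·⟩ H + β`. The Christoffel symbols
`tangentPart (fderiv ℝ F u) (fderiv ℝ (fderiv ℝ F) u X Y)` account for differentiating `β` in a
fixed direction `Z` with constant arguments `X`, `Y`. -/
lemma codazzi (hol : o ≠ l) (hU : IsOpen U) (hF : ContDiffOn ℝ ∞ F U)
    (hfr : ∀ u ∈ U, ∃ v μ p q, IsAdaptedFrame (fderiv ℝ F u) (fderiv ℝ (fderiv ℝ F) u)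
      o l v μ p q (H u)) {u : E} (hu : u ∈ U) (X Y Z : E) :
    traceless F H u Z (tangentPart (fderiv ℝ F u) (fderiv ℝ (fderiv ℝ F) u X Y))
        + normalPart (fderiv ℝ F u) (fderiv ℝ (fun w => traceless F H w X Y) u Z)
        + ⟪fderiv ℝ F u X, fderiv ℝ F u Y⟫ • normalPart (fderiv ℝ F u) (fderiv ℝ H u Z)
      = traceless F H u X (tangentPart (fderiv ℝ F u) (fderiv ℝ (fderiv ℝ F) u Z Y))
        + normalPart (fderiv ℝ F u) (fderiv ℝ (fun w => traceless F H w Z Y) u X)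
        + ⟪fderiv ℝ F u Z, fderiv ℝ F u Y⟫ • normalPart (fderiv ℝ F u) (fderiv ℝ H u X) := by
  obtain ⟨d1, d2, d3, dT, dβ⟩ := differentiableAt_data hol hU hF hfr hu
  obtain ⟨v, μ, p, q, hv⟩ := hfr u hu
  have hinj := hv.injective
  have hc := hF.contDiffAt (hU.mem_nhds hu)
  have symm2 : ∀ X Y, fderiv ℝ (fderiv ℝ F) u X Y = fderiv ℝ (fderiv ℝ F) u Y X :=
    hc.isSymmSndFDerivAt two_le_smooth
  have d1X : ∀ X, DifferentiableAt ℝ (fun w => fderiv ℝ F w X) u :=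
    fun X => d1.clm_apply (differentiableAt_const _)
  have d2XY : ∀ X Y, DifferentiableAt ℝ (fun w => fderiv ℝ (fderiv ℝ F) w X Y) u := fun X Y =>
    (d2.clm_apply (differentiableAt_const _)).clm_apply (differentiableAt_const _)
  have f1X : ∀ X Z, fderiv ℝ (fun w => fderiv ℝ F w X) u Z = fderiv ℝ (fderiv ℝ F) u Z X := by
    intro X Z
    rw [fderiv_clm_apply d1 (differentiableAt_const _)]
    simp
  -- the third derivative is symmetric
  have symm3 : ∀ X Z Y, fderiv ℝ (fun w => fderiv ℝ (fderiv ℝ F) w X Y) u Z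
      = fderiv ℝ (fun w => fderiv ℝ (fderiv ℝ F) w Z Y) u X := by
    intro X Z Y
    have hk : ContDiffAt ℝ ∞ (fun w => fderiv ℝ F w Y) u :=
      ContDiffAt.clm_apply (hc.fderiv_right (by simp)) contDiffAt_const
    have hkd : DifferentiableAt ℝ (fderiv ℝ (fun w => fderiv ℝ F w Y)) u :=
      (hk.fderiv_right (m := ∞) (by simp)).differentiableAt (by simp)
    have key : ∀ X, (fun w => fderiv ℝ (fderiv ℝ F) w X Y)
        =ᶠ[nhds u] fun w => fderiv ℝ (fun w => fderiv ℝ F w Y) w X := by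
      intro X
      filter_upwards [hU.mem_nhds hu] with w hw
      have := (differentiableAt_data hol hU hF hfr hw).1
      rw [fderiv_clm_apply this (differentiableAt_const _)]
      simp
    have hs : ∀ X Z, fderiv ℝ (fderiv ℝ (fun w => fderiv ℝ F w Y)) u X Z
        = fderiv ℝ (fderiv ℝ (fun w => fderiv ℝ F w Y)) u Z X :=
      hk.isSymmSndFDerivAt two_le_smooth
    rw [(key X).fderiv_eq, (key Z).fderiv_eq, fderiv_clm_apply hkd (differentiableAt_const _),
      fderiv_clm_apply hkd (differentiableAt_const _)]
    simpa using hs Z X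
  -- the normal component of the third derivative
  have main : ∀ X Y Z, normalPart (fderiv ℝ F u)
      (fderiv ℝ (fun w => fderiv ℝ (fderiv ℝ F) w X Y) u Z)
      = traceless F H u Z (tangentPart (fderiv ℝ F u) (fderiv ℝ (fderiv ℝ F) u X Y))
        + normalPart (fderiv ℝ F u) (fderiv ℝ (fun w => traceless F H w X Y) u Z)
        + ⟪fderiv ℝ F u X, fderiv ℝ F u Y⟫ • normalPart (fderiv ℝ F u) (fderiv ℝ H u Z)
        + (⟪fderiv ℝ F u Z, fderiv ℝ (fderiv ℝ F) u X Y⟫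
          + ⟪fderiv ℝ (fderiv ℝ F) u Z X, fderiv ℝ F u Y⟫
          + ⟪fderiv ℝ F u X, fderiv ℝ (fderiv ℝ F) u Z Y⟫) • H u := by
    intro X Y Z
    have dΓ : DifferentiableAt ℝ
        (fun w => tangentPart (fderiv ℝ F w) (fderiv ℝ (fderiv ℝ F) w X Y)) u :=
      dT.clm_apply (d2XY X Y)
    have split : (fun w => fderiv ℝ (fderiv ℝ F) w X Y) = fun w =>
        fderiv ℝ F w (tangentPart (fderiv ℝ F w) (fderiv ℝ (fderiv ℝ F) w X Y))
          + traceless F H w X Y + ⟪fderiv ℝ F w X, fderiv ℝ F w Y⟫ • H w := by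
      funext w
      rw [traceless, normalPart_eq]
      abel
    have hsplit := congrArg (fun T => fderiv ℝ T u Z) split
    have hd : fderiv ℝ (fun w =>
        fderiv ℝ F w (tangentPart (fderiv ℝ F w) (fderiv ℝ (fderiv ℝ F) w X Y))
          + traceless F H w X Y + ⟪fderiv ℝ F w X, fderiv ℝ F w Y⟫ • H w) u Z
        = fderiv ℝ F u (fderiv ℝ
            (fun w => tangentPart (fderiv ℝ F w) (fderiv ℝ (fderiv ℝ F) w X Y)) u Z)
          + fderiv ℝ (fderiv ℝ F) u Z
            (tangentPart (fderiv ℝ F u) (fderiv ℝ (fderiv ℝ F) u X Y))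
          + fderiv ℝ (fun w => traceless F H w X Y) u Z
          + (⟪fderiv ℝ F u X, fderiv ℝ F u Y⟫ • fderiv ℝ H u Z
            + (⟪fderiv ℝ F u X, fderiv ℝ (fderiv ℝ F) u Z Y⟫
              + ⟪fderiv ℝ (fderiv ℝ F) u Z X, fderiv ℝ F u Y⟫) • H u) := by
      have hi : DifferentiableAt ℝ (fun w => ⟪fderiv ℝ F w X, fderiv ℝ F w Y⟫) u :=
        (d1X X).inner ℝ (d1X Y)
      have hA := d1.clm_apply dΓ
      have hAβ := hA.fun_add (dβ X Y)
      rw [fderiv_fun_add hAβ (hi.fun_smul d3), fderiv_fun_add hA (dβ X Y), fderiv_clm_apply d1 dΓ,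
        fderiv_fun_smul hi d3]
      simp only [add_apply, smul_apply, ContinuousLinearMap.comp_apply,
        ContinuousLinearMap.flip_apply, ContinuousLinearMap.smulRight_apply]
      rw [fderiv_inner_apply ℝ (d1X X) (d1X Y), f1X, f1X]
    have hH : normalPart (fderiv ℝ F u) (H u) = H u := normalPart_of_orthogonal _ hv.normal_h
    rw [hsplit, hd]
    simp only [map_add, map_smul, normalPart_apply_range hinj, hH]
    rw [traceless, inner_apply_tangentPart hinj]
    simp only [add_smul]
    abel
  have e := main X Y Z
  rw [symm3, main Z Y X] at e
  have hcoef : ⟪fderiv ℝ F u X, fderiv ℝ (fderiv ℝ F) u Z Y⟫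
          + ⟪fderiv ℝ (fderiv ℝ F) u X Z, fderiv ℝ F u Y⟫
          + ⟪fderiv ℝ F u Z, fderiv ℝ (fderiv ℝ F) u X Y⟫
      = ⟪fderiv ℝ F u Z, fderiv ℝ (fderiv ℝ F) u X Y⟫
          + ⟪fderiv ℝ (fderiv ℝ F) u Z X, fderiv ℝ F u Y⟫
          + ⟪fderiv ℝ F u X, fderiv ℝ (fderiv ℝ F) u Z Y⟫ := by
    rw [symm2 X Z]; ring
  rw [hcoef] at e
  exact (add_right_cancel e).symm

/-- If `X` lies in the nullity of `β` at `u`, then it extends to a smooth field in the nullity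
nearby; consequently the derivative of `β(X, ·)` takes values in the image of `β`. The extension is
given by Cramer's rule for the two equations that cut out the nullity. -/
lemma exists_fderiv_traceless_eq (hol : o ≠ l) (hU : IsOpen U) (hF : ContDiffOn ℝ ∞ F U)
    (hfr : ∀ u ∈ U, ∃ v μ p q, IsAdaptedFrame (fderiv ℝ F u) (fderiv ℝ (fderiv ℝ F) u)
      o l v μ p q (H u)) {u : E} (hu : u ∈ U) {X : E} (hX : ∀ Y, traceless F H u X Y = 0) (Z : E) :
    ∃ ξ, ∀ Y, fderiv ℝ (fun w => traceless F H w X Y) u Z = traceless F H u ξ Y := by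
  obtain ⟨-, -, -, -, dβ⟩ := differentiableAt_data hol hU hF hfr hu
  obtain ⟨v, μ, p, q, hv⟩ := hfr u hu
  -- the quadratic form `⟨β, p⟩`, whose restriction to `v o`, `v l` is nondegenerate near `u`
  let Q : E → E → E → ℝ := fun w Y Z => ⟪traceless F H w Y Z, p⟫
  have dQ : ∀ Y Z, DifferentiableAt ℝ (fun w => Q w Y Z) u :=
    fun Y Z => (dβ Y Z).inner ℝ (differentiableAt_const _)
  let D : E → ℝ := fun w => Q w (v o) (v o) * Q w (v l) (v l) - Q w (v o) (v l) * Q w (v l) (v o)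
  let D₁ : E → ℝ := fun w => Q w (v o) X * Q w (v l) (v l) - Q w (v o) (v l) * Q w (v l) X
  let D₂ : E → ℝ := fun w => Q w (v o) (v o) * Q w (v l) X - Q w (v o) X * Q w (v l) (v o)
  have dD : DifferentiableAt ℝ D u :=
    ((dQ _ _).mul (dQ _ _)).sub ((dQ _ _).mul (dQ _ _))
  have dD₁ : DifferentiableAt ℝ D₁ u :=
    ((dQ _ _).mul (dQ _ _)).sub ((dQ _ _).mul (dQ _ _))
  have dD₂ : DifferentiableAt ℝ D₂ u :=
    ((dQ _ _).mul (dQ _ _)).sub ((dQ _ _).mul (dQ _ _))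
  have symm : ∀ Y Z, traceless F H u Y Z = traceless F H u Z Y := by
    intro Y Z
    rw [traceless_eq hv, traceless_eq hv]
    congr 2 <;> ring
  have hQX : ∀ Y, Q u Y X = 0 := fun Y => by simp [Q, symm Y X, hX]
  have hD₁ : D₁ u = 0 := by simp [D₁, hQX]
  have hD₂ : D₂ u = 0 := by simp [D₂, hQX]
  have hD : D u ≠ 0 := by
    have e : D u = -μ ^ 2 := by
      simp only [D, Q, traceless_eq hv, inner_add_left, inner_smul_left, hv.inner_p_p,
        real_inner_comm p q, hv.inner_p_q, basis_coord_self, hol, hol.symm, conj_trivial,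
        if_true, if_false]
      ring
    rw [e, neg_ne_zero]
    exact pow_ne_zero _ hv.ne_zero
  -- Cramer's rule gives a field in the nullity near `u`
  have null : ∀ Y, (fun w => D w • traceless F H w X Y - D₁ w • traceless F H w (v o) Y
      - D₂ w • traceless F H w (v l) Y) =ᶠ[nhds u] fun _ => 0 := by
    intro Y
    filter_upwards [hU.mem_nhds hu, dD.continuousAt.eventually_ne hD] with w hw hDw
    obtain ⟨v', μ', p', q', hv'⟩ := hfr w hw
    set a := v'.coord o
    set b := v'.coord l
    set ξ : E := D w • X - D₁ w • v o - D₂ w • v l with hξ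
    have hQ : ∀ Y Z, Q w Y Z = (μ' * ⟪p', p⟫) * (a Y * a Z - b Y * b Z)
        + (μ' * ⟪q', p⟫) * (a Y * b Z + b Y * a Z) := by
      intro Y Z
      simp only [Q, traceless_eq hv', inner_add_left, inner_smul_left, conj_trivial, a, b]
      ring
    have haξ : a ξ = D w * a X - D₁ w * a (v o) - D₂ w * a (v l) := by simp [hξ]
    have hbξ : b ξ = D w * b X - D₁ w * b (v o) - D₂ w * b (v l) := by simp [hξ]
    have hDw' : D w = Q w (v o) (v o) * Q w (v l) (v l) - Q w (v o) (v l) * Q w (v l) (v o) := rfl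
    have hD₁w : D₁ w = Q w (v o) X * Q w (v l) (v l) - Q w (v o) (v l) * Q w (v l) X := rfl
    have hD₂w : D₂ w = Q w (v o) (v o) * Q w (v l) X - Q w (v o) X * Q w (v l) (v o) := rfl
    have e1 : Q w (v o) ξ = 0 := by
      have : Q w (v o) ξ = D w * Q w (v o) X - D₁ w * Q w (v o) (v o)
          - D₂ w * Q w (v o) (v l) := by
        rw [hQ, hQ, hQ, hQ, haξ, hbξ]; ring
      rw [this, hDw', hD₁w, hD₂w]; ring
    have e2 : Q w (v l) ξ = 0 := by
      have : Q w (v l) ξ = D w * Q w (v l) X - D₁ w * Q w (v l) (v o)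
          - D₂ w * Q w (v l) (v l) := by
        rw [hQ, hQ, hQ, hQ, haξ, hbξ]; ring
      rw [this, hDw', hD₁w, hD₂w]; ring
    rw [hQ] at e1 e2
    generalize μ' * ⟪p', p⟫ = c at *
    generalize μ' * ⟪q', p⟫ = c' at *
    set m := (c * a (v o) + c' * b (v o)) * (c' * a (v l) - c * b (v l))
      - (c' * a (v o) - c * b (v o)) * (c * a (v l) + c' * b (v l)) with hm
    have hDm : D w = m * (a (v o) * b (v l) - b (v o) * a (v l)) := by
      rw [hDw', hQ, hQ, hQ, hQ, hm]; ring
    have hm0 : m ≠ 0 := fun h => hDw (by rw [hDm, h, zero_mul])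
    have ha0 : a ξ = 0 := by
      have : m * a ξ = 0 := by
        rw [hm]; linear_combination (c' * a (v l) - c * b (v l)) * e1
          - (c' * a (v o) - c * b (v o)) * e2
      exact (mul_eq_zero.1 this).resolve_left hm0
    have hb0 : b ξ = 0 := by
      have : m * b ξ = 0 := by
        rw [hm]; linear_combination (c * a (v o) + c' * b (v o)) * e2
          - (c * a (v l) + c' * b (v l)) * e1
      exact (mul_eq_zero.1 this).resolve_left hm0
    have hβ : traceless F H w ξ Y = 0 := by
      rw [traceless_eq hv']
      change (μ' * (a ξ * a Y - b ξ * b Y)) • p' + (μ' * (a ξ * b Y + b ξ * a Y)) • q' = 0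
      rw [ha0, hb0]; simp
    have e3 : ξ = (1 : ℝ) • (D w • X + (-D₁ w) • v o) + (-D₂ w) • v l := by
      rw [hξ]; module
    rw [e3, traceless_linear_left, traceless_linear_left] at hβ
    rw [← hβ]; module
  refine ⟨(D u)⁻¹ • (fderiv ℝ D₁ u Z • v o + fderiv ℝ D₂ u Z • v l), fun Y => ?_⟩
  have h := congrArg (fun T : E →L[ℝ] W => T Z) (null Y).fderiv_eq
  rw [fderiv_fun_sub ((dD.fun_smul (dβ _ _)).fun_sub (dD₁.fun_smul (dβ _ _)))
      (dD₂.fun_smul (dβ _ _)),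
    fderiv_fun_sub (dD.fun_smul (dβ _ _)) (dD₁.fun_smul (dβ _ _)), fderiv_fun_smul dD (dβ _ _),
    fderiv_fun_smul dD₁ (dβ _ _), fderiv_fun_smul dD₂ (dβ _ _)] at h
  simp [hX, hD₁, hD₂] at h
  have e4 : (D u)⁻¹ • (fderiv ℝ D₁ u Z • v o + fderiv ℝ D₂ u Z • v l)
      = ((D u)⁻¹ * fderiv ℝ D₁ u Z) • v o + ((D u)⁻¹ * fderiv ℝ D₂ u Z) • v l := by module
  rw [e4, traceless_linear_left]
  have h' : D u • fderiv ℝ (fun w => traceless F H w X Y) u Z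
      = fderiv ℝ D₁ u Z • traceless F H u (v o) Y + fderiv ℝ D₂ u Z • traceless F H u (v l) Y := by
    rw [← sub_eq_zero, ← h]; abel
  calc _ = (D u)⁻¹ • (D u • fderiv ℝ (fun w => traceless F H w X Y) u Z) := by
        rw [smul_smul, inv_mul_cancel₀ hD, one_smul]
    _ = _ := by rw [h']; module

/-- The mean curvature vector of an immersion with adapted frames is parallel, and its shape
operator is `‖H‖²` times the identity. -/
theorem fderiv_meanCurvature (hol : o ≠ l) (hι : ∀ i : ι, ∃ j, j ≠ o ∧ j ≠ l ∧ j ≠ i)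
    (hU : IsOpen U) (hF : ContDiffOn ℝ ∞ F U)
    (hfr : ∀ u ∈ U, ∃ v μ p q, IsAdaptedFrame (fderiv ℝ F u) (fderiv ℝ (fderiv ℝ F) u)
      o l v μ p q (H u)) {u : E} (hu : u ∈ U) (Z : E) :
    fderiv ℝ H u Z = -‖H u‖ ^ 2 • fderiv ℝ F u Z := by
  obtain ⟨d1, d2, d3, dT, dβ⟩ := differentiableAt_data hol hU hF hfr hu
  have cod := codazzi hol hU hF hfr hu
  have nul := fun X hX Z => exists_fderiv_traceless_eq (X := X) hol hU hF hfr hu hX Z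
  obtain ⟨v, μ, p, q, hv⟩ := id (hfr u hu)
  have hinj := hv.injective
  set A := fderiv ℝ F u with hA
  set S := fderiv ℝ (fderiv ℝ F) u with hS
  set N := normalPart A with hN
  have hNp : N p = p := normalPart_of_orthogonal _ hv.normal_p
  have hNq : N q = q := normalPart_of_orthogonal _ hv.normal_q
  have hNβ : ∀ X Y, N (traceless F H u X Y) = traceless F H u X Y := by
    intro X Y
    rw [traceless_eq hv, map_add, map_smul, map_smul, hNp, hNq]
  have symm : ∀ Y Z, traceless F H u Y Z = traceless F H u Z Y := by
    intro Y Z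
    rw [traceless_eq hv, traceless_eq hv]
    congr 2 <;> ring
  have hnull : ∀ j, j ≠ o → j ≠ l → ∀ Y, traceless F H u (v j) Y = 0 := by
    intro j hjo hjl Y
    simp [traceless_eq hv, Ne.symm hjo, Ne.symm hjl]
  -- the Codazzi equation with arguments `v j`, `v j`, `v i`, for a null vector `v j`
  have step : ∀ j, j ≠ o → j ≠ l → ∃ ξ, ∀ i, i ≠ j →
      N (fderiv ℝ H u (v i)) = traceless F H u (v i) ξ := by
    intro j hjo hjl
    have hj := hnull j hjo hjl
    obtain ⟨ξ, hξ⟩ := nul (v j) hj (v j)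
    refine ⟨ξ - tangentPart A (S (v j) (v j)), fun i hij => ?_⟩
    have c := cod (v j) (v j) (v i)
    obtain ⟨ξ', hξ'⟩ := nul (v j) hj (v i)
    have s1 : (fun w => traceless F H w (v i) (v j)) =ᶠ[nhds u]
        fun w => traceless F H w (v j) (v i) := by
      filter_upwards [hU.mem_nhds hu] with w hw
      obtain ⟨v', μ', p', q', hv'⟩ := hfr w hw
      rw [traceless_eq hv', traceless_eq hv']
      congr 2 <;> ring
    rw [hξ' (v j), symm ξ', hj, s1.fderiv_eq, hξ (v i), hj, hNβ, hv.orthonormal, hv.orthonormal,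
      if_pos rfl, if_neg hij, map_zero, one_smul, zero_smul, add_zero, zero_add, add_zero] at c
    have e5 : ξ - tangentPart A (S (v j) (v j))
        = (1 : ℝ) • ξ + (-1 : ℝ) • tangentPart A (S (v j) (v j)) := by module
    rw [e5, traceless_linear_right, symm _ ξ, ← c]
    module
  have hnull' : ∀ j, j ≠ o → j ≠ l → N (fderiv ℝ H u (v j)) = 0 := by
    intro j hjo hjl
    obtain ⟨k, hko, hkl, hkj⟩ := hι j
    obtain ⟨ξ, hξ⟩ := step k hko hkl
    rw [hξ j hkj.symm, hnull j hjo hjl]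
  -- the `H`-component of the Codazzi equation
  have hβH : ∀ w ∈ U, ∀ X Y, ⟪traceless F H w X Y, H w⟫ = 0 := by
    intro w hw X Y
    obtain ⟨v', μ', p', q', hv'⟩ := hfr w hw
    rw [traceless_eq hv', inner_add_left, inner_smul_left, inner_smul_left, hv'.inner_p_h,
      hv'.inner_q_h]
    simp
  have hNH : ∀ w, ⟪N w, H u⟫ = ⟪w, H u⟫ := by
    intro w
    rw [inner_normalPart_comm hinj, normalPart_of_orthogonal _ hv.normal_h]
  have hcomp : ∀ X Y Z, ⟪fderiv ℝ (fun w => traceless F H w X Y) u Z, H u⟫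
      = -⟪traceless F H u X Y, N (fderiv ℝ H u Z)⟫ := by
    intro X Y Z
    have e6 : (fun w => ⟪traceless F H w X Y, H w⟫) =ᶠ[nhds u] fun _ => (0 : ℝ) := by
      filter_upwards [hU.mem_nhds hu] with w hw using hβH w hw X Y
    have e7 := congrArg (fun T : E →L[ℝ] ℝ => T Z) e6.fderiv_eq
    rw [fderiv_inner_apply ℝ (dβ X Y) d3] at e7
    rw [← inner_normalPart_comm hinj, ← hN, hNβ]
    simp at e7
    linarith
  obtain ⟨j, hjo, hjl, -⟩ := hι o
  obtain ⟨ξ, hξ⟩ := step j hjo hjl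
  have hω : ∀ i, ⟪N (fderiv ℝ H u (v i)), H u⟫ = 0 := by
    intro i
    by_cases hi : i = o ∨ i = l
    · rw [hξ i (by rcases hi with rfl | rfl <;> [exact hjo.symm; exact hjl.symm]), hβH u hu]
    · rw [not_or] at hi
      rw [hnull' i hi.1 hi.2, inner_zero_left]
  have hT : ∀ i k Y, ⟪traceless F H u (v i) Y, N (fderiv ℝ H u (v k))⟫
      = ⟪traceless F H u (v k) Y, N (fderiv ℝ H u (v i))⟫ := by
    intro i k Y
    have c := congrArg (fun w => ⟪w, H u⟫) (cod (v i) Y (v k))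
    simp only [inner_add_left, inner_smul_left, hω, hNH, hcomp, hβH u hu, mul_zero] at c
    linarith
  -- evaluated on `v o` and `v l`, the symmetry says that `ξ` lies in the nullity of `β`
  have t1 := hT o l (v o)
  have t2 := hT o l (v l)
  rw [hξ o hjo.symm, hξ l hjl.symm] at t1 t2
  simp only [traceless_eq hv, inner_add_left, inner_add_right, inner_smul_left, inner_smul_right,
    hv.inner_p_p, hv.inner_q_q, real_inner_comm p q, hv.inner_p_q, basis_coord_self, hol,
    hol.symm, conj_trivial, if_true, if_false] at t1 t2
  have hμ := mul_self_ne_zero.2 hv.ne_zero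
  have z1 : v.coord l ξ = 0 := by
    have : μ * μ * v.coord l ξ = 0 := by linear_combination (-1 / 2 : ℝ) * t1
    exact (mul_eq_zero.1 this).resolve_left hμ
  have z2 : v.coord o ξ = 0 := by
    have : μ * μ * v.coord o ξ = 0 := by linear_combination (1 / 2 : ℝ) * t2
    exact (mul_eq_zero.1 this).resolve_left hμ
  have hpar : ∀ i, N (fderiv ℝ H u (v i)) = 0 := by
    intro i
    by_cases hi : i = o ∨ i = l
    · rw [hξ i (by rcases hi with rfl | rfl <;> [exact hjo.symm; exact hjl.symm]),
        traceless_eq hv, z1, z2]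
      simp
    · rw [not_or] at hi
      exact hnull' i hi.1 hi.2
  have hpar' : N (fderiv ℝ H u Z) = 0 := by
    have : (N.comp (fderiv ℝ H u)).toLinearMap = 0 := v.ext fun i => hpar i
    exact congrArg (fun T : E →ₗ[ℝ] W => T Z) this
  -- the tangential component, by differentiating `⟨H, A Y⟩ = 0`
  have htan : ∀ Y, ⟪A Y, fderiv ℝ H u Z⟫ = -‖H u‖ ^ 2 * ⟪A Y, A Z⟫ := by
    intro Y
    have dY : DifferentiableAt ℝ (fun w => fderiv ℝ F w Y) u :=
      d1.clm_apply (differentiableAt_const _)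
    have e6 : (fun w => ⟪fderiv ℝ F w Y, H w⟫) =ᶠ[nhds u] fun _ => (0 : ℝ) := by
      filter_upwards [hU.mem_nhds hu] with w hw
      obtain ⟨v', μ', p', q', hv'⟩ := hfr w hw
      exact hv'.normal_h Y
    have e7 := congrArg (fun T : E →L[ℝ] ℝ => T Z) e6.fderiv_eq
    rw [fderiv_inner_apply ℝ dY d3, fderiv_clm_apply d1 (differentiableAt_const _)] at e7
    simp only [fderiv_fun_const, Pi.zero_apply, ContinuousLinearMap.comp_zero, zero_add,
      ContinuousLinearMap.flip_apply, zero_apply] at e7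
    rw [← hS, ← hNH, hv.form, inner_add_left, inner_add_left, inner_smul_left, inner_smul_left,
      inner_smul_left, hv.inner_p_h, hv.inner_q_h, real_inner_self_eq_norm_sq] at e7
    simp only [conj_trivial, mul_zero, add_zero] at e7
    linear_combination e7 + ‖H u‖ ^ 2 * real_inner_comm (A Z) (A Y)
  rw [normalPart_eq, sub_eq_zero] at hpar'
  rw [hpar']
  have : tangentPart A (fderiv ℝ H u Z) = -‖H u‖ ^ 2 • Z := by
    apply hinj
    rw [← sub_eq_zero, ← inner_self_eq_zero (𝕜 := ℝ), inner_sub_right]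
    rw [← map_sub, inner_apply_tangentPart hinj, htan, map_smul, inner_smul_right, sub_self]
  rw [this, map_smul]

end LocalTheory

/-! ### Immersions of a manifold in charts -/

section Charts

variable {n d : ℕ} {M : Type*} [TopologicalSpace M] [ChartedSpace (EuclideanSpace ℝ (Fin n)) M]
  {f : M → EuclideanSpace ℝ (Fin d)}

/-- The expression of `f` in the preferred chart around `x`. -/
def inChart {G : Type*} (f : M → G) (x : M) (u : EuclideanSpace ℝ (Fin n)) : G :=
  f ((extChartAt (𝓡 n) x).symm u)

lemma differential_eq_fderiv (hf : ContMDiff (𝓡 n) 𝓘(ℝ, EuclideanSpace ℝ (Fin d)) ∞ f) (x : M)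
    (X : EuclideanSpace ℝ (Fin n)) :
    differential (n := n) f x X = fderiv ℝ (inChart f x) (extChartAt (𝓡 n) x x) X := by
  have h : MDifferentiableAt (𝓡 n) 𝓘(ℝ, EuclideanSpace ℝ (Fin d)) f x :=
    (hf x).mdifferentiableAt (by simp)
  have h1 := h.mfderiv
  have h2 : writtenInExtChartAt (𝓡 n) 𝓘(ℝ, EuclideanSpace ℝ (Fin d)) x f = inChart f x := rfl
  rw [h2, modelWithCornersSelf_coe, Set.range_id, fderivWithin_univ] at h1
  exact congrArg (fun T : EuclideanSpace ℝ (Fin n) →L[ℝ] EuclideanSpace ℝ (Fin d) => T X) h1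

lemma normalSpace_euclideanTangent (f : M → EuclideanSpace ℝ (Fin d)) (x : M) :
    normalSpace (n := n) euclideanTangent f x = (tangentImage (n := n) f x)ᗮ := by
  rw [normalSpace, euclideanTangent, top_inf_eq]

lemma IsIsometricImmersion.injective [RiemannianBundle (fun y : M => TangentSpace (𝓡 n) y)]
    (hf : IsIsometricImmersion (n := n) f) (x : M) :
    Function.Injective (differential (n := n) f x) := by
  rw [injective_iff_map_eq_zero]
  intro X hX
  have h := hf.isometric x X X
  rw [hX, inner_zero_left] at h
  exact inner_self_eq_zero.1 h.symm

variable [IsManifold (𝓡 n) ∞ M]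

lemma contDiffOn_inChart (hf : ContMDiff (𝓡 n) 𝓘(ℝ, EuclideanSpace ℝ (Fin d)) ∞ f) (x : M) :
    ContDiffOn ℝ ∞ (inChart f x) (extChartAt (𝓡 n) x).target := by
  rw [← contMDiffOn_iff_contDiffOn]
  exact hf.comp_contMDiffOn (contMDiffOn_extChartAt_symm x)

/-- Change of charts: the first and second derivatives of `f` in the chart around `x`, at `x`, in
terms of those in the chart around `x₀`. -/
lemma exists_chart_change (hf : ContMDiff (𝓡 n) 𝓘(ℝ, EuclideanSpace ℝ (Fin d)) ∞ f) (x₀ : M)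
    {u : EuclideanSpace ℝ (Fin n)} (hu : u ∈ (extChartAt (𝓡 n) x₀).target) {x : M}
    (hx : (extChartAt (𝓡 n) x₀).symm u = x) :
    ∃ (T : EuclideanSpace ℝ (Fin n) →L[ℝ] EuclideanSpace ℝ (Fin n))
      (B : EuclideanSpace ℝ (Fin n) → EuclideanSpace ℝ (Fin n) → EuclideanSpace ℝ (Fin n)),
      (∀ X, fderiv ℝ (inChart f x) (extChartAt (𝓡 n) x x) X
        = fderiv ℝ (inChart f x₀) u (T X)) ∧
      ∀ X Y, fderiv ℝ (fderiv ℝ (inChart f x)) (extChartAt (𝓡 n) x x) X Y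
        = fderiv ℝ (fderiv ℝ (inChart f x₀)) u (T X) (T Y) + fderiv ℝ (inChart f x₀) u (B X Y) := by
  set a := extChartAt (𝓡 n) x x with ha
  let τ : EuclideanSpace ℝ (Fin n) → EuclideanSpace ℝ (Fin n) :=
    extChartAt (𝓡 n) x₀ ∘ (extChartAt (𝓡 n) x).symm
  have hxs : x ∈ (extChartAt (𝓡 n) x₀).source := hx ▸ (extChartAt (𝓡 n) x₀).map_target hu
  have hsx : (extChartAt (𝓡 n) x).symm a = x := extChartAt_to_inv x
  have hτa : τ a = u := by
    simp only [τ, Function.comp_apply]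
    rw [hsx, ← hx]
    exact (extChartAt (𝓡 n) x₀).right_inv hu
  have hτ : ContDiffAt ℝ ∞ τ a := by
    have h := contDiffWithinAt_ext_coord_change (I := 𝓡 n) (n := ∞) x₀ x (y := a) (by
      rw [PartialEquiv.trans_source, PartialEquiv.symm_source]
      refine ⟨mem_extChartAt_target x, ?_⟩
      rw [Set.mem_preimage, hsx]
      exact hxs)
    rwa [modelWithCornersSelf_coe, Set.range_id, contDiffWithinAt_univ] at h
  have hev : inChart f x =ᶠ[nhds a] inChart f x₀ ∘ τ := by
    have hc : ContinuousAt (extChartAt (𝓡 n) x).symm a := continuousAt_extChartAt_symm x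
    have hs : (extChartAt (𝓡 n) x₀).source ∈ nhds ((extChartAt (𝓡 n) x).symm a) := by
      rw [hsx]
      exact extChartAt_source_mem_nhds' hxs
    filter_upwards [hc hs] with w hw
    simp only [inChart, Function.comp_apply, τ]
    rw [(extChartAt (𝓡 n) x₀).left_inv hw]
  have hF : ContDiffAt ℝ ∞ (inChart f x₀) (τ a) := by
    rw [hτa]
    exact (contDiffOn_inChart hf x₀).contDiffAt ((isOpen_extChartAt_target x₀).mem_nhds hu)
  have hD : fderiv ℝ (inChart f x) =ᶠ[nhds a]
      fun w => (fderiv ℝ (inChart f x₀) (τ w)).comp (fderiv ℝ τ w) := by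
    have e1 : ∀ᶠ w in nhds a, DifferentiableAt ℝ (inChart f x₀) (τ w) :=
      hτ.continuousAt.eventually ((hF.of_le (m := 1) (by simp)).eventually (by simp)
        |>.mono fun w hw => hw.differentiableAt (by simp))
    have e2 : ∀ᶠ w in nhds a, DifferentiableAt ℝ τ w :=
      ((hτ.of_le (m := 1) (by simp)).eventually (by simp)).mono
        fun w hw => hw.differentiableAt (by simp)
    filter_upwards [hev.fderiv (𝕜 := ℝ), e1, e2] with w h0 h1 h2
    rw [h0]
    exact fderiv_comp w h1 h2
  have hDF : DifferentiableAt ℝ (fderiv ℝ (inChart f x₀)) (τ a) :=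
    (hF.fderiv_right (m := ∞) (by simp)).differentiableAt (by simp)
  have hDτ : DifferentiableAt ℝ (fderiv ℝ τ) a :=
    (hτ.fderiv_right (m := ∞) (by simp)).differentiableAt (by simp)
  have hτd : DifferentiableAt ℝ τ a := hτ.differentiableAt (by simp)
  refine ⟨fderiv ℝ τ a, fun X Y => fderiv ℝ (fderiv ℝ τ) a X Y, fun X => ?_, fun X Y => ?_⟩
  · rw [hD.eq_of_nhds, hτa]; rfl
  · rw [hD.fderiv_eq]
    have hc : HasFDerivAt (fun w => fderiv ℝ (inChart f x₀) (τ w))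
        ((fderiv ℝ (fderiv ℝ (inChart f x₀)) (τ a)).comp (fderiv ℝ τ a)) a :=
      hDF.hasFDerivAt.comp a hτd.hasFDerivAt
    rw [(hc.clm_comp hDτ.hasFDerivAt).fderiv, hτa]
    simp [add_comm]

/-- The differential and the second fundamental form of an immersion, at any point of the chart
around `x₀`, in terms of the derivatives in this chart. -/
lemma exists_equiv_in_chart (hf : ContMDiff (𝓡 n) 𝓘(ℝ, EuclideanSpace ℝ (Fin d)) ∞ f)
    (hinj : ∀ x, Function.Injective (differential (n := n) f x)) (x₀ : M)
    {u : EuclideanSpace ℝ (Fin n)} (hu : u ∈ (extChartAt (𝓡 n) x₀).target) {x : M}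
    (hx : (extChartAt (𝓡 n) x₀).symm u = x) :
    ∃ T : EuclideanSpace ℝ (Fin n) ≃ₗ[ℝ] EuclideanSpace ℝ (Fin n),
      (∀ X : EuclideanSpace ℝ (Fin n),
        differential (n := n) f x X = fderiv ℝ (inChart f x₀) u (T X)) ∧
      Function.Injective (fderiv ℝ (inChart f x₀) u) ∧
      tangentImage (n := n) f x = LinearMap.range (fderiv ℝ (inChart f x₀) u).toLinearMap ∧
      normalProj (n := n) euclideanTangent f x = normalPart (fderiv ℝ (inChart f x₀) u) ∧
      ∀ X Y : EuclideanSpace ℝ (Fin n), secondFundamentalForm (n := n) euclideanTangent f x X Y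
        = normalPart (fderiv ℝ (inChart f x₀) u)
          (fderiv ℝ (fderiv ℝ (inChart f x₀)) u (T X) (T Y)) := by
  obtain ⟨T, B, h1, h2⟩ := exists_chart_change hf x₀ hu hx
  have h1' : ∀ X : EuclideanSpace ℝ (Fin n),
      differential (n := n) f x X = fderiv ℝ (inChart f x₀) u (T X) := fun X => by
    rw [differential_eq_fderiv hf, h1]
  have hT : Function.Injective T.toLinearMap := fun X Y hXY =>
    hinj x (by rw [h1' X, h1' Y]; exact congrArg _ hXY)
  have hTs : Function.Surjective T := LinearMap.injective_iff_surjective.1 hT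
  have hA : Function.Injective (fderiv ℝ (inChart f x₀) u) := by
    intro X Y hXY
    obtain ⟨X, rfl⟩ := hTs X
    obtain ⟨Y, rfl⟩ := hTs Y
    rw [← h1', ← h1'] at hXY
    rw [hinj x hXY]
  have hr : tangentImage (n := n) f x
      = LinearMap.range (fderiv ℝ (inChart f x₀) u).toLinearMap := by
    ext w
    constructor
    · rintro ⟨X, rfl⟩
      exact ⟨T X, (h1' X).symm⟩
    · rintro ⟨X, rfl⟩
      obtain ⟨X, rfl⟩ := hTs X
      exact ⟨X, h1' X⟩
  have hN : normalProj (n := n) euclideanTangent f x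
      = normalPart (fderiv ℝ (inChart f x₀) u) :=
    starProjection_eq_normalPart hA _ (by rw [normalSpace_euclideanTangent, hr])
  refine ⟨LinearEquiv.ofBijective T.toLinearMap ⟨hT, hTs⟩, h1', hA, hr, hN, fun X Y => ?_⟩
  change normalProj (n := n) euclideanTangent f x
    (fderiv ℝ (fderiv ℝ (inChart f x)) (extChartAt (𝓡 n) x x) X Y) = _
  rw [hN, h2, map_add, normalPart_apply_range hA, add_zero]
  rfl

end Charts

/-! ### The mean curvature vector field -/

section Frames

/-- The entries of the canonical matrices with `γ₁ = 0`, in terms of Kronecker symbols. -/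
lemma wintgenMatrix_apply {n m : ℕ} (hn : 4 ≤ n) (hm : 3 ≤ m) (μ γ₂ : ℝ) (a : Fin m)
    (i j : Fin n) :
    wintgenMatrix n μ 0 γ₂ a i j
      = (if i = j then 1 else 0) * (γ₂ * if (⟨2, hm⟩ : Fin m) = a then 1 else 0)
        + μ * ((if (⟨0, by omega⟩ : Fin n) = i then 1 else 0)
            * (if (⟨0, by omega⟩ : Fin n) = j then 1 else 0)
          - (if (⟨1, by omega⟩ : Fin n) = i then 1 else 0)
            * (if (⟨1, by omega⟩ : Fin n) = j then 1 else 0))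
          * (if (⟨0, by omega⟩ : Fin m) = a then 1 else 0)
        + μ * ((if (⟨0, by omega⟩ : Fin n) = i then 1 else 0)
            * (if (⟨1, by omega⟩ : Fin n) = j then 1 else 0)
          + (if (⟨1, by omega⟩ : Fin n) = i then 1 else 0)
            * (if (⟨0, by omega⟩ : Fin n) = j then 1 else 0))
          * (if (⟨1, by omega⟩ : Fin m) = a then 1 else 0) := by
  obtain ⟨a, ha⟩ := a
  obtain ⟨i, hi⟩ := i
  obtain ⟨j, hj⟩ := j
  match a with
  | 0 | 1 | 2 =>
    simp only [wintgenMatrix, Matrix.of_apply, Fin.mk.injEq]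
    rcases i with _ | _ | i <;> rcases j with _ | _ | j <;> simp
  | a + 3 => simp [wintgenMatrix]

variable {n m : ℕ} {M : Type*} [TopologicalSpace M] [ChartedSpace (EuclideanSpace ℝ (Fin n)) M]
  [IsManifold (𝓡 n) ∞ M] [RiemannianBundle (fun y : M => TangentSpace (𝓡 n) y)]
  {d : ℕ} {f : M → EuclideanSpace ℝ (Fin d)}

/-- The canonical form of the shape operators with `γ₁ = 0`, at the points of the chart around
`x₀`. The mean curvature vector is `γ₂ η₃`. -/
lemma IsWintgenFrame.exists_isAdaptedFrame (hn : 4 ≤ n) (hm : 3 ≤ m)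
    (hf : IsIsometricImmersion (n := n) f) {x : M}
    {e : OrthonormalBasis (Fin n) ℝ (TangentSpace (𝓡 n) x)}
    {η : OrthonormalBasis (Fin m) ℝ (normalSpace (n := n) euclideanTangent f x)} {μ γ₂ : ℝ}
    (h : IsWintgenFrame euclideanTangent f x e η μ 0 γ₂) (hμ : μ ≠ 0) (x₀ : M)
    {u : EuclideanSpace ℝ (Fin n)} (hu : u ∈ (extChartAt (𝓡 n) x₀).target)
    (hx : (extChartAt (𝓡 n) x₀).symm u = x) :
    ∃ v μ p q, IsAdaptedFrame (fderiv ℝ (inChart f x₀) u)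
      (fderiv ℝ (fderiv ℝ (inChart f x₀)) u)
      (⟨0, by omega⟩ : Fin n) (⟨1, by omega⟩ : Fin n) v μ p q
      (γ₂ • (η ⟨2, hm⟩ : EuclideanSpace ℝ (Fin d))) := by
  obtain ⟨T, hT, hinj, hr, hN, hα⟩ := exists_equiv_in_chart hf.smooth hf.injective x₀ hu hx
  set A := fderiv ℝ (inChart f x₀) u
  set S := fderiv ℝ (fderiv ℝ (inChart f x₀)) u
  let T' : TangentSpace (𝓡 n) x ≃ₗ[ℝ] EuclideanSpace ℝ (Fin n) := T
  let v : Module.Basis (Fin n) ℝ (EuclideanSpace ℝ (Fin n)) := e.toBasis.map T'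
  have hvT : ∀ i, v i = T (e i) := fun i => by
    simp only [v, Module.Basis.map_apply, OrthonormalBasis.coe_toBasis]
    rfl
  have hd : ∀ i, differential (n := n) f x (e i) = A (v i) := fun i =>
    (hT (e i)).trans (congrArg A (hvT i).symm)
  have hNS : normalSpace (n := n) euclideanTangent f x = (LinearMap.range A.toLinearMap)ᗮ := by
    rw [normalSpace_euclideanTangent, hr]
  have horth : ∀ i j, ⟪A (v i), A (v j)⟫ = if i = j then (1 : ℝ) else 0 := by
    intro i j
    rw [← hd, ← hd]
    exact (hf.isometric x (e i) (e j)).trans (orthonormal_iff_ite.1 e.orthonormal i j)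
  have hnormal : ∀ a X, ⟪A X, (η a : EuclideanSpace ℝ (Fin d))⟫ = 0 := by
    intro a X
    exact (Submodule.mem_orthogonal _ _).1 (hNS.le (η a).2) _ ⟨X, rfl⟩
  have hη : ∀ a b, ⟪(η a : EuclideanSpace ℝ (Fin d)), (η b : EuclideanSpace ℝ (Fin d))⟫
      = if a = b then (1 : ℝ) else 0 := orthonormal_iff_ite.1 η.orthonormal
  -- a normal vector is determined by its components in the basis `η`
  have hext : ∀ w₁ w₂ : EuclideanSpace ℝ (Fin d), normalPart A w₁ = w₁ → normalPart A w₂ = w₂ →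
      (∀ a, ⟪w₁, (η a : EuclideanSpace ℝ (Fin d))⟫ = ⟪w₂, (η a : EuclideanSpace ℝ (Fin d))⟫) →
      w₁ = w₂ := by
    intro w₁ w₂ h1 h2 h12
    have mem : ∀ w, normalPart A w = w → w ∈ normalSpace (n := n) euclideanTangent f x := by
      intro w hw
      rw [hNS, Submodule.mem_orthogonal]
      rintro _ ⟨X, rfl⟩
      rw [← hw]
      exact inner_apply_normalPart hinj X w
    have : (⟨w₁, mem w₁ h1⟩ : normalSpace (n := n) euclideanTangent f x) = ⟨w₂, mem w₂ h2⟩ := by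
      refine InnerProductSpace.ext_inner_right_basis η.toBasis fun a => ?_
      rw [OrthonormalBasis.coe_toBasis]
      exact h12 a
    exact congrArg Subtype.val this
  have hidem : ∀ w, normalPart A (normalPart A w) = normalPart A w := fun w =>
    normalPart_of_orthogonal A fun X => inner_apply_normalPart hinj X w
  have hNη : ∀ a, normalPart A (η a : EuclideanSpace ℝ (Fin d)) = η a := fun a =>
    normalPart_of_orthogonal A (hnormal a)
  refine ⟨v, μ, η ⟨0, by omega⟩, η ⟨1, by omega⟩, ?_⟩
  refine ⟨horth, hμ, hnormal _, hnormal _, fun X => ?_, ?_, ?_, ?_, ?_, ?_, ?_⟩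
  · rw [inner_smul_right, hnormal, mul_zero]
  · rw [hη, if_pos rfl]
  · rw [hη, if_pos rfl]
  · rw [hη, if_neg (by simp)]
  · rw [inner_smul_right, hη, if_neg (by simp), mul_zero]
  · rw [inner_smul_right, hη, if_neg (by simp), mul_zero]
  set o : Fin n := ⟨0, by omega⟩
  set l : Fin n := ⟨1, by omega⟩
  let B₁ : EuclideanSpace ℝ (Fin n) →ₗ[ℝ] EuclideanSpace ℝ (Fin n) →ₗ[ℝ]
      EuclideanSpace ℝ (Fin d) := LinearMap.mk₂ ℝ (fun X Y => normalPart A (S X Y))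
    (by intros; simp) (by intros; simp) (by intros; simp) (by intros; simp)
  let B₂ : EuclideanSpace ℝ (Fin n) →ₗ[ℝ] EuclideanSpace ℝ (Fin n) →ₗ[ℝ]
      EuclideanSpace ℝ (Fin d) := LinearMap.mk₂ ℝ (fun X Y =>
        ⟪A X, A Y⟫ • (γ₂ • (η ⟨2, hm⟩ : EuclideanSpace ℝ (Fin d)))
        + (μ * (v.coord o X * v.coord o Y - v.coord l X * v.coord l Y))
          • (η ⟨0, by omega⟩ : EuclideanSpace ℝ (Fin d))
        + (μ * (v.coord o X * v.coord l Y + v.coord l X * v.coord o Y))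
          • (η ⟨1, by omega⟩ : EuclideanSpace ℝ (Fin d)))
    (by intros; simp only [map_add, inner_add_left]; module)
    (by intros; simp only [map_smul, inner_smul_left, smul_eq_mul, conj_trivial]; module)
    (by intros; simp only [map_add, inner_add_right]; module)
    (by intros; simp only [map_smul, inner_smul_right, smul_eq_mul]; module)
  have hB : B₁ = B₂ := by
    refine LinearMap.ext_basis v v fun i j => hext _ _ (hidem _) ?_ fun a => ?_
    · simp only [B₂, LinearMap.mk₂_apply, map_add, map_smul, hNη]
    · have h1 : B₁ (v i) (v j)
          = secondFundamentalForm (n := n) euclideanTangent f x (e i) (e j) := by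
        rw [hvT, hvT]
        exact (hα (e i) (e j)).symm
      rw [h1, h a i j]
      simp only [B₂, LinearMap.mk₂_apply, inner_add_left, inner_smul_left, conj_trivial, hη, horth,
        basis_coord_self]
      exact wintgenMatrix_apply hn hm μ γ₂ a i j
  intro X Y
  exact congrArg (fun B : EuclideanSpace ℝ (Fin n) →ₗ[ℝ] EuclideanSpace ℝ (Fin n) →ₗ[ℝ]
      EuclideanSpace ℝ (Fin d) => B X Y) hB

end Frames

section Global

variable {n d : ℕ} {M : Type*} [TopologicalSpace M] [ChartedSpace (EuclideanSpace ℝ (Fin n)) M]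

/-- A function on a connected manifold whose derivative vanishes in all charts is constant. -/
lemma exists_eq_const_of_fderiv_inChart [ConnectedSpace M] {G : Type*} [NormedAddCommGroup G]
    [NormedSpace ℝ G] {g : M → G}
    (hg : ∀ x : M, ∀ u ∈ (extChartAt (𝓡 n) x).target,
      DifferentiableAt ℝ (inChart (n := n) g x) u ∧ fderiv ℝ (inChart (n := n) g x) u = 0) :
    ∃ c, ∀ x, g x = c := by
  have hloc : IsLocallyConstant g := by
    rw [IsLocallyConstant.iff_eventually_eq]
    intro x
    obtain ⟨ε, hε, hb⟩ := Metric.isOpen_iff.1 (isOpen_extChartAt_target (I := 𝓡 n) x) _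
      (mem_extChartAt_target x)
    have hc : ContinuousAt (extChartAt (𝓡 n) x) x := continuousAt_extChartAt x
    filter_upwards [hc (Metric.ball_mem_nhds _ hε), extChartAt_source_mem_nhds (I := 𝓡 n) x]
      with y hy hys
    have h := Metric.isOpen_ball.is_const_of_fderiv_eq_zero (𝕜 := ℝ)
      (convex_ball (extChartAt (𝓡 n) x x) ε).isPreconnected
      (fun u hu => (hg x u (hb hu)).1.differentiableWithinAt)
      (fun u hu => (hg x u (hb hu)).2) hy (Metric.mem_ball_self hε)
    simpa only [inChart, (extChartAt (𝓡 n) x).left_inv hys, extChartAt_to_inv] using h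
  obtain ⟨x₀⟩ := (inferInstance : Nonempty M)
  exact ⟨g x₀, fun x => hloc.apply_eq_of_preconnectedSpace x x₀⟩

/-- `H` is a smooth normal field along `f` that is parallel and has shape operator `‖H‖² I`,
expressed in charts. -/
structure IsParallelUmbilicField (f H : M → EuclideanSpace ℝ (Fin d)) : Prop where
  smooth : ∀ x : M, ∀ u ∈ (extChartAt (𝓡 n) x).target, ContDiffAt ℝ ∞ (inChart (n := n) H x) u
  normal : ∀ x : M, ∀ u ∈ (extChartAt (𝓡 n) x).target, ∀ X,
    ⟪fderiv ℝ (inChart (n := n) f x) u X, inChart (n := n) H x u⟫ = 0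
  fderiv_eq : ∀ x : M, ∀ u ∈ (extChartAt (𝓡 n) x).target, ∀ X,
    fderiv ℝ (inChart (n := n) H x) u X
      = -‖inChart (n := n) H x u‖ ^ 2 • fderiv ℝ (inChart (n := n) f x) u X

namespace IsParallelUmbilicField

variable {f H : M → EuclideanSpace ℝ (Fin d)}

lemma exists_norm_eq [ConnectedSpace M] (h : IsParallelUmbilicField (n := n) f H) :
    ∃ κ, ∀ x, ‖H x‖ = κ := by
  obtain ⟨c, hc⟩ := exists_eq_const_of_fderiv_inChart (n := n) (g := fun x => ⟪H x, H x⟫) (by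
    intro x u hu
    have hd : DifferentiableAt ℝ (inChart (n := n) H x) u :=
      (h.smooth x u hu).differentiableAt (by simp)
    refine ⟨hd.inner ℝ hd, ?_⟩
    ext X
    change fderiv ℝ (fun w => ⟪inChart (n := n) H x w, inChart (n := n) H x w⟫) u X = 0
    rw [fderiv_inner_apply ℝ hd hd, h.fderiv_eq x u hu, inner_smul_right, inner_smul_left,
      real_inner_comm, h.normal x u hu]
    simp)
  refine ⟨√c, fun x => ?_⟩
  rw [← hc x, norm_eq_sqrt_real_inner]

/-- The point `f + H / κ²` is constant, since `dH = -κ² df`; it is the centre of the sphere that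
contains the image of `f`. -/
lemma exists_center [ConnectedSpace M] (h : IsParallelUmbilicField (n := n) f H)
    (hf : ∀ x : M, ∀ u ∈ (extChartAt (𝓡 n) x).target,
      DifferentiableAt ℝ (inChart (n := n) f x) u) {κ : ℝ} (hκ : κ ≠ 0) (hH : ∀ x, ‖H x‖ = κ) :
    ∃ P, ∀ x, f x + (κ ^ 2)⁻¹ • H x = P := by
  refine exists_eq_const_of_fderiv_inChart (n := n) fun x u hu => ?_
  have hd : DifferentiableAt ℝ (inChart (n := n) H x) u :=
    (h.smooth x u hu).differentiableAt (by simp)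
  refine ⟨(hf x u hu).fun_add (hd.fun_const_smul _), ?_⟩
  ext1 X
  change fderiv ℝ (fun w => inChart (n := n) f x w + (κ ^ 2)⁻¹ • inChart (n := n) H x w) u X = 0
  rw [fderiv_fun_add (hf x u hu) (hd.fun_const_smul _), fderiv_fun_const_smul hd]
  have : ‖inChart (n := n) H x u‖ = κ := hH _
  rw [add_apply, smul_apply, h.fderiv_eq x u hu, this, smul_smul, mul_neg,
    inv_mul_cancel₀ (pow_ne_zero 2 hκ)]
  simp

lemma contMDiff [IsManifold (𝓡 n) ∞ M] (h : IsParallelUmbilicField (n := n) f H) :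
    ContMDiff (𝓡 n) 𝓘(ℝ, EuclideanSpace ℝ (Fin d)) ∞ H := by
  intro x
  have h1 : ContMDiffAt (𝓡 n) 𝓘(ℝ, EuclideanSpace ℝ (Fin d)) ∞
      (inChart (n := n) H x ∘ extChartAt (𝓡 n) x) x :=
    ContMDiffAt.comp x ((h.smooth x _ (mem_extChartAt_target x)).contMDiffAt)
      contMDiffAt_extChartAt
  refine h1.congr_of_eventuallyEq ?_
  filter_upwards [extChartAt_source_mem_nhds (I := 𝓡 n) x] with y hy
  simp only [Function.comp_apply, inChart, (extChartAt (𝓡 n) x).left_inv hy]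

end IsParallelUmbilicField

variable [IsManifold (𝓡 n) ∞ M] [RiemannianBundle (fun y : M => TangentSpace (𝓡 n) y)]
  {m : ℕ} {f : M → EuclideanSpace ℝ (Fin d)}

/-- The mean curvature vector field `γ₂ η₃` is parallel. -/
theorem isParallelUmbilicField_of_frames (hn : 4 ≤ n) (hm : 3 ≤ m)
    (hf : IsIsometricImmersion (n := n) f)
    (e : ∀ x : M, OrthonormalBasis (Fin n) ℝ (TangentSpace (𝓡 n) x))
    (η : ∀ x : M, OrthonormalBasis (Fin m) ℝ (normalSpace (n := n) euclideanTangent f x))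
    (μ γ₂ : M → ℝ)
    (hframe : ∀ x : M, IsWintgenFrame euclideanTangent f x (e x) (η x) (μ x) 0 (γ₂ x))
    (hμ : ∀ x, μ x ≠ 0) :
    IsParallelUmbilicField (n := n) f
      (fun x => γ₂ x • (η x ⟨2, hm⟩ : EuclideanSpace ℝ (Fin d))) := by
  have hfr := fun (x₀ : M) u hu =>
    (hframe ((extChartAt (𝓡 n) x₀).symm u)).exists_isAdaptedFrame hn hm hf (hμ _) x₀ hu rfl
  have hol : (⟨0, by omega⟩ : Fin n) ≠ ⟨1, by omega⟩ := by simp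
  refine ⟨fun x u hu => ?_, fun x u hu X => ?_, fun x u hu X => ?_⟩
  · exact contDiffAt_of_frames hol (isOpen_extChartAt_target x) (contDiffOn_inChart hf.smooth x)
      (hfr x) hu
  · obtain ⟨v, μ, p, q, hv⟩ := hfr x u hu
    exact hv.normal_h X
  · refine fderiv_meanCurvature (F := inChart f x) hol ?_ (isOpen_extChartAt_target x)
      (contDiffOn_inChart hf.smooth x) (hfr x) hu X
    intro i
    -- besides `o` and `l` there are at least two more indices, because `4 ≤ n`
    by_cases hi : i = ⟨2, by omega⟩
    · exact ⟨⟨3, by omega⟩, by simp, by simp, by simp [hi]⟩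
    · exact ⟨⟨2, by omega⟩, by simp, by simp, Ne.symm hi⟩

end Global

/-! ### The same immersion in the hypersphere -/

section Sphere

variable {n d : ℕ} {M : Type*} [TopologicalSpace M] [ChartedSpace (EuclideanSpace ℝ (Fin n)) M]

/-- The normal space in the sphere is the orthogonal complement of `h` in the normal space in `ℝᵈ`,
if `h` is radial. -/
lemma normalProj_sphereTangent (f : M → EuclideanSpace ℝ (Fin d)) {x : M}
    {P h : EuclideanSpace ℝ (Fin d)} {κ : ℝ} (hκ : κ ≠ 0) (hh : ‖h‖ = κ)
    (hn : h ∈ normalSpace (n := n) euclideanTangent f x) (hP : f x + (κ ^ 2)⁻¹ • h = P)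
    (w : EuclideanSpace ℝ (Fin d)) :
    normalProj (n := n) (sphereTangent P) f x w
      = normalProj (n := n) euclideanTangent f x w - ((κ ^ 2)⁻¹ * ⟪h, w⟫) • h := by
  have hκ2 : κ ^ 2 ≠ 0 := pow_ne_zero 2 hκ
  have hy : f x - P = -(κ ^ 2)⁻¹ • h := by rw [← hP]; module
  have hle : normalSpace (n := n) (sphereTangent P) f x
      ≤ normalSpace (n := n) euclideanTangent f x := by
    rw [normalSpace_euclideanTangent]
    exact inf_le_right
  have hhh : ⟪h, h⟫ = κ ^ 2 := by rw [real_inner_self_eq_norm_sq, hh]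
  have hproj : normalProj (n := n) euclideanTangent f x w
      ∈ normalSpace (n := n) euclideanTangent f x := Submodule.starProjection_apply_mem _ _
  have hrad : ⟪h, normalProj (n := n) euclideanTangent f x w⟫ = ⟪h, w⟫ := by
    rw [normalProj, ← Submodule.inner_starProjection_left_eq_right,
      Submodule.starProjection_eq_self_iff.2 hn]
  refine Submodule.eq_starProjection_of_mem_orthogonal ?_ ?_
  · refine Submodule.mem_inf.2 ⟨?_, ?_⟩
    · rw [sphereTangent, Submodule.mem_orthogonal_singleton_iff_inner_right, hy, inner_smul_left,
        inner_sub_right, inner_smul_right, hhh, hrad]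
      field_simp
      simp
    · rw [← normalSpace_euclideanTangent]
      exact Submodule.sub_mem _ hproj (Submodule.smul_mem _ _ hn)
  · have e : w - (normalProj (n := n) euclideanTangent f x w - ((κ ^ 2)⁻¹ * ⟪h, w⟫) • h)
        = (w - normalProj (n := n) euclideanTangent f x w) + ((κ ^ 2)⁻¹ * ⟪h, w⟫) • h := by abel
    rw [e]
    refine Submodule.add_mem _ ?_ (Submodule.smul_mem _ _ ?_)
    · exact Submodule.orthogonal_le hle (Submodule.sub_starProjection_mem_orthogonal w)
    · rw [Submodule.mem_orthogonal']
      intro k hk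
      have h1 := (Submodule.mem_inf.1 hk).1
      rw [sphereTangent, Submodule.mem_orthogonal_singleton_iff_inner_right, hy, inner_smul_left]
        at h1
      exact (mul_eq_zero.1 h1).resolve_left (by simpa using hκ)

/-- The normal curvature tensor in terms of the derivative of the normal projections `Q`. -/
lemma normalCurvature_eq (V : EuclideanSpace ℝ (Fin d) → Submodule ℝ (EuclideanSpace ℝ (Fin d)))
    (f : M → EuclideanSpace ℝ (Fin d)) (x : M)
    {Q : EuclideanSpace ℝ (Fin n) → EuclideanSpace ℝ (Fin d) →L[ℝ] EuclideanSpace ℝ (Fin d)}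
    (hQ : ∀ u ∈ (extChartAt (𝓡 n) x).target,
      normalProj (n := n) V f ((extChartAt (𝓡 n) x).symm u) = Q u)
    (hs : ∀ u ∈ (extChartAt (𝓡 n) x).target, ContDiffAt ℝ ∞ Q u)
    (X Y : EuclideanSpace ℝ (Fin n)) (ξ : EuclideanSpace ℝ (Fin d)) :
    normalCurvature (n := n) V f x X Y ξ
      = Q (extChartAt (𝓡 n) x x) (fderiv ℝ Q (extChartAt (𝓡 n) x x) X
          (fderiv ℝ Q (extChartAt (𝓡 n) x x) Y ξ))
        - Q (extChartAt (𝓡 n) x x) (fderiv ℝ Q (extChartAt (𝓡 n) x x) Y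
          (fderiv ℝ Q (extChartAt (𝓡 n) x x) X ξ)) := by
  have ht := isOpen_extChartAt_target (I := 𝓡 n) x
  set a := extChartAt (𝓡 n) x x with ha
  have hat : a ∈ (extChartAt (𝓡 n) x).target := mem_extChartAt_target x
  have hQd : ∀ u ∈ (extChartAt (𝓡 n) x).target, DifferentiableAt ℝ Q u :=
    fun u hu => (hs u hu).differentiableAt (by simp)
  have hQ2 : DifferentiableAt ℝ (fderiv ℝ Q) a :=
    ((hs a hat).fderiv_right (m := ∞) (by simp)).differentiableAt (by simp)
  have first : ∀ Y : EuclideanSpace ℝ (Fin n), ∀ u ∈ (extChartAt (𝓡 n) x).target,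
      chartNormalDeriv (n := n) V f x Y
        (fun u => normalProj (n := n) V f ((extChartAt (𝓡 n) x).symm u) ξ) u
      = Q u (fderiv ℝ Q u Y ξ) := by
    intro Y u hu
    have e : (fun u => normalProj (n := n) V f ((extChartAt (𝓡 n) x).symm u) ξ)
        =ᶠ[nhds u] fun u => Q u ξ := by
      filter_upwards [ht.mem_nhds hu] with w hw
      rw [hQ w hw]
    rw [chartNormalDeriv, hQ u hu, e.fderiv_eq,
      fderiv_clm_apply (hQd u hu) (differentiableAt_const _)]
    simp
  have second : ∀ X Y : EuclideanSpace ℝ (Fin n), chartNormalDeriv (n := n) V f x X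
      (chartNormalDeriv (n := n) V f x Y
        (fun u => normalProj (n := n) V f ((extChartAt (𝓡 n) x).symm u) ξ)) a
      = Q a (fderiv ℝ Q a X (fderiv ℝ Q a Y ξ))
        + Q a (Q a (fderiv ℝ (fderiv ℝ Q) a X Y ξ)) := by
    intro X Y
    have e : chartNormalDeriv (n := n) V f x Y
        (fun u => normalProj (n := n) V f ((extChartAt (𝓡 n) x).symm u) ξ)
        =ᶠ[nhds a] fun u => Q u (fderiv ℝ Q u Y ξ) := by
      filter_upwards [ht.mem_nhds hat] with w hw using first Y w hw
    have d1 : DifferentiableAt ℝ (fun u => fderiv ℝ Q u Y) a :=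
      hQ2.clm_apply (differentiableAt_const _)
    rw [chartNormalDeriv, hQ a hat, e.fderiv_eq, fderiv_clm_apply (hQd a hat)
      (d1.clm_apply (differentiableAt_const _)), fderiv_clm_apply d1 (differentiableAt_const _),
      fderiv_clm_apply hQ2 (differentiableAt_const _)]
    simp [add_comm]
  have symm : ∀ X Y, fderiv ℝ (fderiv ℝ Q) a X Y = fderiv ℝ (fderiv ℝ Q) a Y X :=
    (hs a hat).isSymmSndFDerivAt two_le_smooth
  refine (congrArg₂ (· - ·) (second X Y) (second Y X)).trans ?_
  rw [symm X Y]
  abel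

/-- The normal curvature in `ℝᵈ` annihilates the parallel field `H`, and it agrees with the normal
curvature in the sphere with centre `P`. The linear map `T` witnesses that it is tensorial. -/
lemma normalCurvature_sphereTangent [IsManifold (𝓡 n) ∞ M]
    {f H : M → EuclideanSpace ℝ (Fin d)}
    (hf : ContMDiff (𝓡 n) 𝓘(ℝ, EuclideanSpace ℝ (Fin d)) ∞ f)
    (hinj : ∀ x, Function.Injective (differential (n := n) f x))
    (hH : IsParallelUmbilicField (n := n) f H) {κ : ℝ} (hκ : κ ≠ 0) (hHκ : ∀ x, ‖H x‖ = κ)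
    {P : EuclideanSpace ℝ (Fin d)}
    (hN' : ∀ x w, normalProj (n := n) (sphereTangent P) f x w
      = normalProj (n := n) euclideanTangent f x w - ((κ ^ 2)⁻¹ * ⟪H x, w⟫) • H x)
    (x : M) (X Y : EuclideanSpace ℝ (Fin n)) :
    ∃ T : EuclideanSpace ℝ (Fin d) →L[ℝ] EuclideanSpace ℝ (Fin d), T (H x) = 0 ∧
      (∀ ξ, normalCurvature (n := n) euclideanTangent f x X Y ξ = T ξ) ∧
      ∀ ξ, normalCurvature (n := n) (sphereTangent P) f x X Y ξ = T ξ := by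
  have ht := isOpen_extChartAt_target (I := 𝓡 n) x
  set a := extChartAt (𝓡 n) x x with ha
  have hat : a ∈ (extChartAt (𝓡 n) x).target := mem_extChartAt_target x
  have hHa : inChart (n := n) H x a = H x := by rw [inChart, ha, extChartAt_to_inv]
  have hFs : ∀ u ∈ (extChartAt (𝓡 n) x).target, ContDiffAt ℝ ∞ (fderiv ℝ (inChart f x)) u :=
    fun u hu => ((contDiffOn_inChart hf x).contDiffAt (ht.mem_nhds hu)).fderiv_right (by simp)
  have hFi : ∀ u ∈ (extChartAt (𝓡 n) x).target,
      Function.Injective (fderiv ℝ (inChart f x) u) := fun u hu => by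
    obtain ⟨T, -, h, -⟩ := exists_equiv_in_chart hf hinj x hu rfl
    exact h
  -- the normal projections in the two ambient spaces, and their derivatives
  let N : EuclideanSpace ℝ (Fin n) → EuclideanSpace ℝ (Fin d) →L[ℝ] EuclideanSpace ℝ (Fin d) :=
    fun u => normalPart (fderiv ℝ (inChart f x) u)
  let K : EuclideanSpace ℝ (Fin n) → EuclideanSpace ℝ (Fin d) := inChart (n := n) H x
  let N' : EuclideanSpace ℝ (Fin n) → EuclideanSpace ℝ (Fin d) →L[ℝ] EuclideanSpace ℝ (Fin d) :=
    fun u => N u - (κ ^ 2)⁻¹ • (innerSL ℝ (K u)).smulRight (K u)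
  have hNp : ∀ u ∈ (extChartAt (𝓡 n) x).target,
      normalProj (n := n) euclideanTangent f ((extChartAt (𝓡 n) x).symm u) = N u :=
    fun u hu => by
      obtain ⟨T, -, -, -, h, -⟩ := exists_equiv_in_chart hf hinj x hu rfl
      exact h
  have hN'a : ∀ u w, N' u w = N u w - ((κ ^ 2)⁻¹ * ⟪K u, w⟫) • K u := by
    intro u w
    simp [N', mul_smul]
  have hNp' : ∀ u ∈ (extChartAt (𝓡 n) x).target,
      normalProj (n := n) (sphereTangent P) f ((extChartAt (𝓡 n) x).symm u) = N' u := by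
    intro u hu
    refine ContinuousLinearMap.ext fun w => ?_
    rw [hN', hNp u hu, hN'a]
    rfl
  have hNs : ∀ u ∈ (extChartAt (𝓡 n) x).target, ContDiffAt ℝ ∞ N u := fun u hu =>
    (contDiffAt_normalPart (hFi u hu)).comp u (hFs u hu)
  have hNs' : ∀ u ∈ (extChartAt (𝓡 n) x).target, ContDiffAt ℝ ∞ N' u := fun u hu => by
    have h1 := hH.smooth x u hu
    have h2 : ContDiffAt ℝ ∞ (fun u => innerSL ℝ (K u)) u :=
      (innerSL ℝ).contDiff.contDiffAt.comp u h1
    exact (hNs u hu).sub ((h2.smulRight h1).const_smul _)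
  have dN : DifferentiableAt ℝ N a := (hNs a hat).differentiableAt (by simp)
  have dN' : DifferentiableAt ℝ N' a := (hNs' a hat).differentiableAt (by simp)
  have dK : DifferentiableAt ℝ K a := (hH.smooth x a hat).differentiableAt (by simp)
  have dF : DifferentiableAt ℝ (fderiv ℝ (inChart f x)) a :=
    (hFs a hat).differentiableAt (by simp)
  set A := fderiv ℝ (inChart f x) a with hA
  set S := fderiv ℝ (fderiv ℝ (inChart f x)) a with hS
  have hKκ : ∀ u, ‖K u‖ = κ := fun u => hHκ _
  have hKd : ∀ X, fderiv ℝ K a X = -κ ^ 2 • A X := fun X => by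
    rw [hH.fderiv_eq x a hat]
    congr 2
    rw [show ‖inChart (n := n) H x a‖ = κ from hKκ a]
  have hAK : ∀ X, ⟪A X, K a⟫ = 0 := hH.normal x a hat
  have hNK : ∀ u ∈ (extChartAt (𝓡 n) x).target, N u (K u) = K u := fun u hu =>
    normalPart_of_orthogonal _ (hH.normal x u hu)
  have hNA : ∀ X, N a (A X) = 0 := fun X => normalPart_apply_range (hFi a hat) X
  have symS : ∀ X Y, S X Y = S Y X :=
    ((contDiffOn_inChart hf x).contDiffAt (ht.mem_nhds hat)).isSymmSndFDerivAt two_le_smooth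
  -- derivatives of the identities `N A = 0` and `N K = K`
  have hDA : ∀ X Y, fderiv ℝ N a X (A Y) = -N a (S X Y) := by
    intro X Y
    have e : (fun u => N u (fderiv ℝ (inChart f x) u Y)) =ᶠ[nhds a] fun _ => 0 := by
      filter_upwards [ht.mem_nhds hat] with u hu using normalPart_apply_range (hFi u hu) Y
    have e' := congrArg
      (fun T : EuclideanSpace ℝ (Fin n) →L[ℝ] EuclideanSpace ℝ (Fin d) => T X) e.fderiv_eq
    rw [fderiv_clm_apply dN (dF.clm_apply (differentiableAt_const _)),
      fderiv_clm_apply dF (differentiableAt_const _)] at e'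
    simp only [add_apply, ContinuousLinearMap.comp_apply, ContinuousLinearMap.flip_apply,
      fderiv_fun_const, Pi.zero_apply, ContinuousLinearMap.comp_zero, zero_add, zero_apply] at e'
    rw [add_comm] at e'
    exact eq_neg_of_add_eq_zero_left e'
  have hDK : ∀ X, fderiv ℝ N a X (K a) = -κ ^ 2 • A X := by
    intro X
    have e : (fun u => N u (K u)) =ᶠ[nhds a] K := by
      filter_upwards [ht.mem_nhds hat] with u hu using hNK u hu
    have e' := congrArg
      (fun T : EuclideanSpace ℝ (Fin n) →L[ℝ] EuclideanSpace ℝ (Fin d) => T X) e.fderiv_eq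
    rw [fderiv_clm_apply dN dK] at e'
    simp only [add_apply, ContinuousLinearMap.comp_apply, ContinuousLinearMap.flip_apply, hKd,
      map_smul, hNA, smul_zero, zero_add] at e'
    exact e'
  have hDsym : ∀ X v w, ⟪fderiv ℝ N a X v, w⟫ = ⟪v, fderiv ℝ N a X w⟫ := by
    intro X v w
    have dv : ∀ v, DifferentiableAt ℝ (fun u => N u v) a :=
      fun v => dN.clm_apply (differentiableAt_const _)
    have fv : ∀ v, fderiv ℝ (fun u => N u v) a X = fderiv ℝ N a X v := fun v => by
      rw [fderiv_clm_apply dN (differentiableAt_const _)]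
      simp
    have e : (fun u => ⟪N u v, w⟫) =ᶠ[nhds a] fun u => ⟪v, N u w⟫ := by
      filter_upwards [ht.mem_nhds hat] with u hu using inner_normalPart_comm (hFi u hu) v w
    have e' := congrArg (fun T : EuclideanSpace ℝ (Fin n) →L[ℝ] ℝ => T X) e.fderiv_eq
    rw [fderiv_inner_apply ℝ (dv v) (differentiableAt_const _),
      fderiv_inner_apply ℝ (differentiableAt_const _) (dv w), fv, fv] at e'
    simpa using e'
  have hD' : ∀ X ξ, fderiv ℝ N' a X ξ
      = fderiv ℝ N a X ξ + ⟪A X, ξ⟫ • K a + ⟪K a, ξ⟫ • A X := by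
    intro X ξ
    have e1 : fderiv ℝ N' a X ξ = fderiv ℝ (fun u => N' u ξ) a X := by
      rw [fderiv_clm_apply dN' (differentiableAt_const _)]
      simp
    have di : DifferentiableAt ℝ (fun u => ⟪K u, ξ⟫) a := dK.inner ℝ (differentiableAt_const _)
    have di' : DifferentiableAt ℝ (fun u => (κ ^ 2)⁻¹ * ⟪K u, ξ⟫) a := di.const_mul _
    have dNξ : DifferentiableAt ℝ (fun u => N u ξ) a := dN.clm_apply (differentiableAt_const _)
    have e2 : (fun u => N' u ξ) = fun u => N u ξ - ((κ ^ 2)⁻¹ * ⟪K u, ξ⟫) • K u :=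
      funext fun u => hN'a u ξ
    rw [e1, e2, fderiv_fun_sub dNξ (di'.fun_smul dK), fderiv_fun_smul di' dK,
      fderiv_const_mul di, fderiv_clm_apply dN (differentiableAt_const _)]
    simp only [sub_apply, add_apply, smul_apply, ContinuousLinearMap.smulRight_apply,
      ContinuousLinearMap.flip_apply, fderiv_fun_const,
      Pi.zero_apply, ContinuousLinearMap.comp_zero, zero_add, hKd]
    rw [fderiv_inner_apply ℝ dK (differentiableAt_const _), hKd, inner_smul_left]
    simp only [fderiv_fun_const, Pi.zero_apply, zero_apply, inner_zero_right, zero_add,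
      conj_trivial, smul_smul, smul_eq_mul]
    have e3 : (κ ^ 2)⁻¹ * ⟪K a, ξ⟫ * -κ ^ 2 = -⟪K a, ξ⟫ := by field_simp
    have e4 : (κ ^ 2)⁻¹ * (-κ ^ 2 * ⟪A X, ξ⟫) = -⟪A X, ξ⟫ := by field_simp
    rw [e3, e4]
    module
  -- the commutator of the derivatives of `N` annihilates `K`
  have hKcomm : ∀ X Y, N a (fderiv ℝ N a X (fderiv ℝ N a Y (K a)))
      = N a (fderiv ℝ N a Y (fderiv ℝ N a X (K a))) := by
    intro X Y
    simp only [hDK, map_smul, hDA, symS X Y]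
  have hKcomm' : ∀ ξ, ⟪K a, fderiv ℝ N a X (fderiv ℝ N a Y ξ)⟫
      = ⟪K a, fderiv ℝ N a Y (fderiv ℝ N a X ξ)⟫ := by
    intro ξ
    rw [← hDsym, ← hDsym, ← hDsym, ← hDsym, hDK, hDK, map_smul, map_smul, hDA, hDA, symS]
  have hN'K : N' a (K a) = 0 := by
    rw [hN'a, hNK a hat, real_inner_self_eq_norm_sq, hKκ, inv_mul_cancel₀ (pow_ne_zero 2 hκ)]
    simp
  have hN'A : ∀ X, N' a (A X) = 0 := fun X => by
    rw [hN'a, hNA, real_inner_comm, hAK]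
    simp
  have hprod : ∀ X Y ξ, N' a (fderiv ℝ N' a X (fderiv ℝ N' a Y ξ))
      = N' a (fderiv ℝ N a X (fderiv ℝ N a Y ξ)) - ⟪K a, ξ⟫ • N' a (N a (S X Y)) := by
    intro X Y ξ
    rw [hD' X, map_add, map_add, map_smul, map_smul, hN'K, hN'A, hD' Y]
    simp only [map_add, map_smul, hDK, hDA, map_neg, hN'A, smul_zero, add_zero, smul_neg]
    abel
  refine ⟨N a ∘L (fderiv ℝ N a X ∘L fderiv ℝ N a Y - fderiv ℝ N a Y ∘L fderiv ℝ N a X),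
    ?_, fun ξ => ?_, fun ξ => ?_⟩
  · rw [← hHa]
    change N a (fderiv ℝ N a X (fderiv ℝ N a Y (K a)) - fderiv ℝ N a Y (fderiv ℝ N a X (K a))) = 0
    rw [map_sub, hKcomm, sub_self]
  · rw [normalCurvature_eq euclideanTangent f x hNp hNs]
    exact (map_sub (N a) _ _).symm
  · rw [normalCurvature_eq (sphereTangent P) f x hNp' hNs', hprod, hprod, symS Y X,
      sub_sub_sub_cancel_right, hN'a, hN'a, hKcomm', sub_sub_sub_cancel_right]
    exact (map_sub (N a) _ _).symm

variable [RiemannianBundle (fun y : M => TangentSpace (𝓡 n) y)]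

/-- The mean curvature vector, in any of the ambient spaces, as a trace in the chart. -/
lemma meanCurvature_eq (V : EuclideanSpace ℝ (Fin d) → Submodule ℝ (EuclideanSpace ℝ (Fin d)))
    {f : M → EuclideanSpace ℝ (Fin d)} (hf : IsIsometricImmersion (n := n) f) (x : M) :
    meanCurvature (n := n) V f x = (1 / (n : ℝ)) • normalProj (n := n) V f x
      (∑ k, fderiv ℝ (fderiv ℝ (inChart f x)) (extChartAt (𝓡 n) x x)
        (gramInv (fderiv ℝ (inChart f x) (extChartAt (𝓡 n) x x))
          (stdOrthonormalBasis ℝ (EuclideanSpace ℝ (Fin n)) k))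
        (stdOrthonormalBasis ℝ (EuclideanSpace ℝ (Fin n)) k)) := by
  have hd := differential_eq_fderiv hf.smooth x
  have hA : Function.Injective (fderiv ℝ (inChart f x) (extChartAt (𝓡 n) x x)) := by
    intro X Y hXY
    rw [← hd, ← hd] at hXY
    exact hf.injective x hXY
  let T : TangentSpace (𝓡 n) x ≃ₗ[ℝ] EuclideanSpace ℝ (Fin n) :=
    LinearEquiv.refl ℝ (EuclideanSpace ℝ (Fin n))
  let v : Module.Basis (Fin n) ℝ (EuclideanSpace ℝ (Fin n)) :=
    (tangentONB (n := n) x).toBasis.map T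
  have hv : ∀ i, v i = tangentONB (n := n) x i := fun i => by
    simp only [v, Module.Basis.map_apply, OrthonormalBasis.coe_toBasis]
    rfl
  rw [← sum_apply_eq_sum_gramInv hA v (fun i j => ?_), map_sum]
  · simp only [hv]
    rfl
  · rw [← hd, ← hd, hv, hv]
    exact (hf.isometric x _ _).trans
      (orthonormal_iff_ite.1 (tangentONB (n := n) x).orthonormal i j)

/-- The normal curvature tensors in `ℝᵈ` and in the sphere have the same norm, because they agree
and the additional normal direction is annihilated. -/
lemma normNormalCurvature_congr {V V' : EuclideanSpace ℝ (Fin d) →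
      Submodule ℝ (EuclideanSpace ℝ (Fin d))} {f : M → EuclideanSpace ℝ (Fin d)} {x : M}
    (h : ∀ X Y : TangentSpace (𝓡 n) x,
      ∃ T : EuclideanSpace ℝ (Fin d) →L[ℝ] EuclideanSpace ℝ (Fin d),
      (∀ w, T (normalProj (n := n) V f x w) = T (normalProj (n := n) V' f x w)) ∧
      (∀ ξ, normalCurvature (n := n) V f x X Y ξ = T ξ) ∧
      ∀ ξ, normalCurvature (n := n) V' f x X Y ξ = T ξ) :
    normNormalCurvature (n := n) V f x = normNormalCurvature (n := n) V' f x := by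
  rw [normNormalCurvature, normNormalCurvature]
  congr 1
  refine Finset.sum_congr rfl fun i _ => Finset.sum_congr rfl fun j _ => ?_
  obtain ⟨T, h1, h2, h3⟩ := h (tangentONB (n := n) x i) (tangentONB (n := n) x j)
  simp only [h2, h3]
  have b := stdOrthonormalBasis ℝ (EuclideanSpace ℝ (Fin d))
  rw [sum_norm_sq_subspace T _ _ b, sum_norm_sq_subspace T _ _ b]
  exact Finset.sum_congr rfl fun k _ => by
    have := h1 (b k)
    rw [normalProj, normalProj] at this
    rw [this]

end Sphere

end WintgenIdeal

end

/-! ### Wintgen ideal submanifolds with `γ₁ = 0` -/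

theorem mainTheorem4 {n m : ℕ} (hn : 4 ≤ n) (hm : 3 ≤ m)
    {M : Type*} [TopologicalSpace M] [ConnectedSpace M]
    [ChartedSpace (EuclideanSpace ℝ (Fin n)) M] [IsManifold (𝓡 n) ∞ M]
    [RiemannianBundle (fun x : M => TangentSpace (𝓡 n) x)]
    [IsContMDiffRiemannianBundle (𝓡 n) ∞ (EuclideanSpace ℝ (Fin n))
      (fun x : M => TangentSpace (𝓡 n) x)]
    (f : M → EuclideanSpace ℝ (Fin (n + m)))
    (hf : WintgenIdeal.IsIsometricImmersion (n := n) f)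
    (hW : WintgenIdeal.IsWintgenIdeal (n := n) WintgenIdeal.euclideanTangent f 0)
    -- pointwise frames in which the shape operators have the canonical form of a
    -- Wintgen ideal submanifold, and the functions `μ`, `γ₁`, `γ₂` that occur in it
    (e : ∀ x : M, OrthonormalBasis (Fin n) ℝ (TangentSpace (𝓡 n) x))
    (η : ∀ x : M, OrthonormalBasis (Fin m) ℝ
      (WintgenIdeal.normalSpace (n := n) WintgenIdeal.euclideanTangent f x))
    (μ γ₁ γ₂ : M → ℝ)
    (hframe : ∀ x : M, WintgenIdeal.IsWintgenFrame WintgenIdeal.euclideanTangent f x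
      (e x) (η x) (μ x) (γ₁ x) (γ₂ x))
    (hμ : ∀ x, μ x ≠ 0) (hγ₁ : ∀ x, γ₁ x = 0) (hγ₂ : ∀ x, γ₂ x ≠ 0) :
    (∃ κ : ℝ, 0 < κ ∧ ∀ x, |γ₂ x| = κ) ∧
    (Continuous γ₂ →
      (∃ κ : ℝ, ∀ x, γ₂ x = κ) ∧
      WintgenIdeal.IsParallelNormalField (n := n) WintgenIdeal.euclideanTangent f
        (fun x => (η x ⟨2, hm⟩ : EuclideanSpace ℝ (Fin (n + m))))) ∧
    (∃ (P : EuclideanSpace ℝ (Fin (n + m))) (r : ℝ), 0 < r ∧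
      Set.range f ⊆ Metric.sphere P r ∧
      WintgenIdeal.IsMinimal (n := n) (WintgenIdeal.sphereTangent P) f ∧
      WintgenIdeal.IsWintgenIdeal (n := n) (WintgenIdeal.sphereTangent P) f (1 / r ^ 2)) := by
  open WintgenIdeal in
  have hframe' : ∀ x : M, IsWintgenFrame euclideanTangent f x (e x) (η x) (μ x) 0 (γ₂ x) :=
    fun x => hγ₁ x ▸ hframe x
  have hH := isParallelUmbilicField_of_frames hn hm hf e η μ γ₂ hframe' hμ
  have hη1 : ∀ x, ‖(η x ⟨2, hm⟩ : EuclideanSpace ℝ (Fin (n + m)))‖ = 1 :=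
    fun x => (η x).orthonormal.1 ⟨2, hm⟩
  set H : M → EuclideanSpace ℝ (Fin (n + m)) :=
    fun x => γ₂ x • (η x ⟨2, hm⟩ : EuclideanSpace ℝ (Fin (n + m))) with hHdef
  obtain ⟨κ, hκ⟩ := hH.exists_norm_eq
  have habs : ∀ x, |γ₂ x| = κ := fun x => by
    rw [← hκ x, hHdef]
    simp only
    rw [norm_smul, hη1, mul_one, Real.norm_eq_abs]
  obtain ⟨x₀⟩ := (inferInstance : Nonempty M)
  have hκ0 : 0 < κ := by
    rw [← habs x₀]
    exact abs_pos.2 (hγ₂ x₀)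
  have hHn : ∀ x, H x ∈ normalSpace (n := n) euclideanTangent f x := fun x =>
    Submodule.smul_mem _ _ (η x ⟨2, hm⟩).2
  refine ⟨⟨κ, hκ0, habs⟩, fun hcont => ?_, ?_⟩
  · have hconst : ∃ c : ℝ, ∀ x, γ₂ x = c := by
      have h := isPreconnected_univ.eq_or_eq_neg_of_sq_eq (f := γ₂) (g := fun _ : M => κ)
        hcont.continuousOn continuousOn_const
        (fun x _ => by
          change γ₂ x ^ 2 = κ ^ 2
          rw [← habs x, sq_abs])
        (fun _ => hκ0.ne')
      rcases h with h | h
      · exact ⟨κ, fun x => h (Set.mem_univ x)⟩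
      · exact ⟨-κ, fun x => h (Set.mem_univ x)⟩
    refine ⟨hconst, ?_⟩
    obtain ⟨c, hc⟩ := hconst
    have hc0 : c ≠ 0 := hc x₀ ▸ hγ₂ x₀
    have hηH : (fun x => (η x ⟨2, hm⟩ : EuclideanSpace ℝ (Fin (n + m)))) = fun x => c⁻¹ • H x := by
      funext x
      simp only [hHdef]
      rw [hc, smul_smul, inv_mul_cancel₀ hc0, one_smul]
    have hs : ContMDiff (𝓡 n) 𝓘(ℝ, EuclideanSpace ℝ (Fin (n + m))) ∞
        (fun x => (η x ⟨2, hm⟩ : EuclideanSpace ℝ (Fin (n + m)))) := by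
      rw [hηH]
      exact (contDiff_const_smul c⁻¹).contMDiff.comp hH.contMDiff
    refine ⟨hs, fun x => (η x ⟨2, hm⟩).2, fun x X => ?_⟩
    have hu := mem_extChartAt_target (I := 𝓡 n) x
    obtain ⟨T, -, hinj, -, hN, -⟩ :=
      exists_equiv_in_chart hf.smooth hf.injective x hu (extChartAt_to_inv x)
    have hd : DifferentiableAt ℝ (inChart (n := n) H x) (extChartAt (𝓡 n) x x) :=
      (hH.smooth x _ hu).differentiableAt (by simp)
    have e1 : inChart (n := n) (fun x => (η x ⟨2, hm⟩ : EuclideanSpace ℝ (Fin (n + m)))) x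
        = fun w => c⁻¹ • inChart (n := n) H x w := by
      rw [hηH]
      rfl
    have key : ∀ X : EuclideanSpace ℝ (Fin n),
        normalPart (fderiv ℝ (inChart f x) (extChartAt (𝓡 n) x x))
          (fderiv ℝ (inChart (n := n)
            (fun x => (η x ⟨2, hm⟩ : EuclideanSpace ℝ (Fin (n + m)))) x)
            (extChartAt (𝓡 n) x x) X) = 0 := by
      intro X
      rw [e1, fderiv_fun_const_smul hd, smul_apply, hH.fderiv_eq x _ hu, map_smul, map_smul,
        normalPart_apply_range hinj, smul_zero, smul_zero]
    rw [hN]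
    exact (congrArg _ (differential_eq_fderiv hs x X)).trans (key X)
  · obtain ⟨P, hP⟩ := hH.exists_center (fun x u hu =>
      ((contDiffOn_inChart hf.smooth x).contDiffAt
        ((isOpen_extChartAt_target x).mem_nhds hu)).differentiableAt (by simp)) hκ0.ne' hκ
    have hN' := fun x => normalProj_sphereTangent f hκ0.ne' (hκ x) (hHn x) (hP x)
    have hn0 : (n : ℝ) ≠ 0 := by
      have : n ≠ 0 := by omega
      exact_mod_cast this
    -- the trace of the second derivative has normal component `n H`
    have htr : ∀ x, normalProj (n := n) euclideanTangent f x
        (∑ k, fderiv ℝ (fderiv ℝ (inChart f x)) (extChartAt (𝓡 n) x x)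
          (gramInv (fderiv ℝ (inChart f x) (extChartAt (𝓡 n) x x))
            (stdOrthonormalBasis ℝ (EuclideanSpace ℝ (Fin n)) k))
          (stdOrthonormalBasis ℝ (EuclideanSpace ℝ (Fin n)) k)) = (n : ℝ) • H x := by
      intro x
      have hu := mem_extChartAt_target (I := 𝓡 n) x
      obtain ⟨T, -, -, -, hN, -⟩ :=
        exists_equiv_in_chart hf.smooth hf.injective x hu (extChartAt_to_inv x)
      obtain ⟨v, μ', p, q, hv⟩ :=
        (hframe' x).exists_isAdaptedFrame hn hm hf (hμ x) x hu (extChartAt_to_inv x)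
      rw [hN, hv.trace_eq (by simp) (stdOrthonormalBasis ℝ (EuclideanSpace ℝ (Fin n))),
        Fintype.card_fin]
    have hmean : ∀ x, meanCurvature (n := n) euclideanTangent f x = H x := by
      intro x
      rw [meanCurvature_eq _ hf, htr, smul_smul, one_div, inv_mul_cancel₀ hn0, one_smul]
    have hmin : IsMinimal (n := n) (sphereTangent P) f := by
      intro x
      have h1 : ∀ w, ⟪H x, w⟫ = ⟪H x, normalProj (n := n) euclideanTangent f x w⟫ := by
        intro w
        rw [normalProj, ← Submodule.inner_starProjection_left_eq_right,
          Submodule.starProjection_eq_self_iff.2 (hHn x)]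
      rw [meanCurvature_eq _ hf, hN', h1, htr, inner_smul_right, real_inner_self_eq_norm_sq, hκ]
      have h2 : (κ ^ 2)⁻¹ * (n * κ ^ 2) = n := by field_simp
      rw [h2, sub_self, smul_zero]
    refine ⟨P, κ⁻¹, inv_pos.2 hκ0, ?_, hmin, fun x => ?_⟩
    · rintro _ ⟨x, rfl⟩
      have h1 : f x - P = -((κ ^ 2)⁻¹ • H x) := by rw [← hP x]; abel
      rw [mem_sphere_iff_norm, h1, norm_neg, norm_smul, hκ, norm_inv, norm_pow, Real.norm_eq_abs,
        abs_of_pos hκ0]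
      field_simp
    · have hR : normNormalCurvature (n := n) euclideanTangent f x
          = normNormalCurvature (n := n) (sphereTangent P) f x := by
        refine normNormalCurvature_congr fun X Y => ?_
        obtain ⟨T, h0, h1, h2⟩ := normalCurvature_sphereTangent hf.smooth hf.injective hH hκ0.ne' hκ
          hN' x X Y
        refine ⟨T, fun w => ?_, h1, h2⟩
        rw [hN', map_sub, map_smul, h0, smul_zero, sub_zero]
      rw [hW x, hmean, hmin x, hκ, hR]
      simp
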